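/- Let $a,b\in\mathbb R\setminus\{0\}$ with $a\neq\pm b$, let $H\in\mathbb R\setminus\{0\}$, and let $\xi\,dz$ be the potential in normal form $$\xi(\lambda)=i\begin{pmatrix}0&a\lambda^{-1}+b\lambda\\ b\lambda^{-1}+a\lambda&0\end{pmatrix}.$$ Let $\tau$ be conjugation by $\mathrm{diag}(1,-1)$. Let $\Lambda \mathrm{SU}(2)_\tau$ be the group of smooth loops $g:S^1\to\mathrm{SU}(2)$ with $g(-\lambda)=\tau g(\lambda)$, and let $\Lambda_+\mathrm{SL}(2,\mathbb C)_\tau$ be the group of smooth loops $g:S^1\to \mathrm{SL}(2,\mathbb C)$ with $g(-\lambda)=\tau g(\lambda)$ that extend holomorphically to $|\lambda|<1$ (with values in $\mathrm{SL}(2,\mathbb C)$ and continuously up to $S^1$) with $g(0)=\mathrm{diag}(r,r^{-1})$ for some $r>0$. The extended framing generated by $\xi\,dz$ is the map $F:\mathbb C\to\Lambda \mathrm{SU}(2)_\tau$ such that for every $z\in\mathbb C$ there is $B(z)\in\Lambda_+\mathrm{SL}(2,\mathbb C)_\tau$ with $\exp(z\,\xi)=F(z)\,B(z)$. With $z=x+iy$,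 a dot denoting $d/dy$, and $\mathrm{dn}(\cdot\,|\,m)$ Jacobi's elliptic function of parameter $m$, put $$v_0(y)=2bH^{-1}\,\mathrm{dn}\!\left(2by\,\middle|\,1-\tfrac{a^2}{b^2}\right),\qquad Q=2abH^{-1},\qquad \omega(\lambda)=ib\lambda^{-1}+ia\lambda,$$ $$\Omega_1(y,\lambda)=\tfrac i2 v_0(y)H\lambda^{-1}+2i\,v_0(y)^{-1}abH^{-1}\lambda ,$$ $$\mathbf f(x,y,\lambda)=x+iy+f(y,\lambda),\qquad f(y,\lambda)=\int_0^y\frac{8ab\lambda\,d\zeta}{4iab\lambda+iH^2\lambda^{-1}v_0(\zeta)^2},$$ $$T(y,\lambda)=\frac1{\sqrt{\omega\,\Omega_1}}\begin{pmatrix}\Omega_1&-\tfrac i2v_0^{-1}\dot v_0\\0&\omega\end{pmatrix},\qquad \sqrt{\omega\,\Omega_1}:=\omega\,\sqrt{\Omega_1/\omega}\ \text{ (principal root)}.$$ Then: 1. $v_0$ is differentiable and has no zeros; $\omega(\lambda)\ne0$ for all $\lambda\in S^1$; and $\Omega_1(y,\lambda)\neq0$ for all $y\in\mathbb R$ and all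 $\lambda\in S^1$ with $\lambda^2\neq-ab/|ab|$. 2. There is exactly one extended framing $F$ generated by $\xi\,dz$. It satisfies $\partial_xF=F\alpha_1$ and $\partial_yF=F\alpha_2$ on $\mathbb R^2\times S^1$, where $$\alpha_1=\frac i2\begin{pmatrix}\dot v_0v_0^{-1}&2v_0^{-1}\lambda^{-1}Q+v_0\lambda H\\ v_0\lambda^{-1}H+2v_0^{-1}\lambda Q&-\dot v_0v_0^{-1}\end{pmatrix},\quad \alpha_2=\frac12\begin{pmatrix}0&-2v_0^{-1}\lambda^{-1}Q+v_0\lambda H\\ -v_0\lambda^{-1}H+2v_0^{-1}\lambda Q&0\end{pmatrix}$$ (the Maurer–Cartan form of the associated family of the Delaunay surface with metric $v_0^2\,|dz|^2$, Hopf differential $\lambda^{-2}Q\,dz^2$ and mean curvature $H$). 3. For all $x,y\in\mathbb R$ and $\lambda\in S^1$ such that $\Omega_1(\zeta,\lambda)\neq0$ for every $\zeta$ between $0$ and $y$ (inclusive) — so for all $x,y\in\mathbb R$ when $\lambda^2\neq-ab/|ab|$ — one has $\Omega_1(y,\lambda)/\omega(\lambda)\notin(-\infty,0]$, the integrand of $f$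 is integrable between $0$ and $y$, and $$F(x+iy,\lambda)=\exp\bigl(\mathbf f(x,y,\lambda)\,\xi(\lambda)\bigr)\,T(y,\lambda).$$ -/

import Mathlib

namespace DelaunayFrame

noncomputable section

/-! ### Jacobi's delta amplitude -/

/-- The elliptic integral of the first kind `F(φ | m)`, as a function of the amplitude `φ`
and the parameter `m`. -/
def ellipticF (φ m : ℝ) : ℝ :=
  ∫ t in (0 : ℝ)..φ, 1 / Real.sqrt (1 - m * Real.sin t ^ 2)

/-- Jacobi's amplitude `am(u | m)`: the inverse function of `F(· | m)`. It is used for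
parameters `m < 1` only, where `F(· | m)` is a bijection of `ℝ`
(see `ellipticF_bijective`). -/
def amplitude (u m : ℝ) : ℝ :=
  Function.invFun (fun φ => ellipticF φ m) u

/-- Jacobi's elliptic function `dn(u | m)` on the real line. -/
def jacobiDn (u m : ℝ) : ℝ :=
  Real.sqrt (1 - m * Real.sin (amplitude u m) ^ 2)

theorem ellipticF_bijective {m : ℝ} (hm : m < 1) :
    Function.Bijective (fun φ => ellipticF φ m) := by
  have hpos : ∀ t : ℝ, 0 < 1 - m * Real.sin t ^ 2 := by
    intro t
    have h0 := sq_nonneg (Real.sin t)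
    have h1 := Real.sin_sq_le_one t
    rcases le_total m 0 with h | h <;> nlinarith
  have hcont : Continuous (fun t : ℝ => 1 / Real.sqrt (1 - m * Real.sin t ^ 2)) := by
    refine Continuous.div continuous_const (by fun_prop) ?_
    intro t
    exact (Real.sqrt_pos.2 (hpos t)).ne'
  have hder : ∀ φ : ℝ, HasDerivAt (fun φ => ellipticF φ m)
      (1 / Real.sqrt (1 - m * Real.sin φ ^ 2)) φ := fun φ =>
    intervalIntegral.integral_hasDerivAt_right (hcont.intervalIntegrable _ _)
      (hcont.stronglyMeasurableAtFilter _ _) hcont.continuousAt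
  set c : ℝ := 1 / Real.sqrt (1 + |m|) with hc
  have hcpos : 0 < c := by positivity
  have hbound : ∀ t : ℝ, c ≤ 1 / Real.sqrt (1 - m * Real.sin t ^ 2) := by
    intro t
    have hs := Real.sqrt_pos.2 (hpos t)
    apply one_div_le_one_div_of_le hs
    apply Real.sqrt_le_sqrt
    have h0 := sq_nonneg (Real.sin t)
    have h1 := Real.sin_sq_le_one t
    have h2 := neg_abs_le m
    have h3 := abs_nonneg m
    nlinarith
  have hg : ∀ φ : ℝ, HasDerivAt (fun φ => ellipticF φ m - c * φ)
      (1 / Real.sqrt (1 - m * Real.sin φ ^ 2) - c) φ := by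
    intro φ
    have h := (hder φ).sub ((hasDerivAt_id φ).const_mul c)
    rw [mul_one] at h
    exact h
  have hmono : Monotone (fun φ => ellipticF φ m - c * φ) := by
    apply monotone_of_deriv_nonneg (fun φ => (hg φ).differentiableAt)
    intro φ
    rw [(hg φ).deriv]
    linarith [hbound φ]
  have hzero : ellipticF 0 m = 0 := by simp [ellipticF]
  constructor
  · have hst : StrictMono (fun φ => ellipticF φ m) := by
      intro x y hxy
      have h := hmono hxy.le
      have h' := mul_lt_mul_of_pos_left hxy hcpos
      simp only at h ⊢
      linarith
    exact hst.injective
  · have hcF : Continuous (fun φ => ellipticF φ m) :=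
      continuous_iff_continuousAt.2 fun φ => (hder φ).continuousAt
    apply hcF.surjective
    · refine Filter.tendsto_atTop_mono' _ ?_
        (Filter.tendsto_id.const_mul_atTop hcpos)
      filter_upwards [Filter.eventually_ge_atTop 0] with φ hφ
      have h := hmono hφ
      simp only [hzero, id] at h ⊢
      linarith
    · refine Filter.tendsto_atBot_mono' _ ?_
        (Filter.tendsto_id.const_mul_atBot hcpos)
      filter_upwards [Filter.eventually_le_atBot 0] with φ hφ
      have h := hmono hφ
      simp only [hzero, id] at h ⊢
      linarith

/-! ### Twisted loops in `SU(2)` and the Iwasawa decomposition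

The symmetric space is `S² = SU(2) / U(1)`; the involution `τ` is conjugation by
`diag(1, -1)`, whose fixed point set is the group of diagonal matrices. -/

/-- The involution `τ` of `SL(2, ℂ)`, conjugation by `diag(1, -1)`. -/
def tau (g : Matrix (Fin 2) (Fin 2) ℂ) : Matrix (Fin 2) (Fin 2) ℂ :=
  !![1, 0; 0, -1] * g * !![1, 0; 0, -1]

/-- A loop of matrices on the unit circle is smooth. -/
def IsSmoothLoop (g : Circle → Matrix (Fin 2) (Fin 2) ℂ) : Prop :=
  ∀ i j, ContDiff ℝ ((⊤ : ℕ∞) : WithTop ℕ∞) (fun t : ℝ => g (Circle.exp t) i j)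

/-- The twisted loop group `Λ SU(2)_τ`. -/
structure IsUnitaryLoop (g : Circle → Matrix (Fin 2) (Fin 2) ℂ) : Prop where
  smooth : IsSmoothLoop g
  mem_SU : ∀ l, g l ∈ Matrix.specialUnitaryGroup (Fin 2) ℂ
  twisted : ∀ l, g (-l) = tau (g l)

/-- The group `Λ₊ SL(2, ℂ)_τ` of twisted loops in `SL(2, ℂ)` that extend holomorphically to
the unit disc, with value `diag(r, 1/r)`, `r > 0`, at the centre. -/
structure IsPositiveLoop (g : Circle → Matrix (Fin 2) (Fin 2) ℂ) : Prop where
  smooth : IsSmoothLoop g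
  det_eq_one : ∀ l, (g l).det = 1
  twisted : ∀ l, g (-l) = tau (g l)
  extends_to_disc : ∃ G : ℂ → Matrix (Fin 2) (Fin 2) ℂ,
    (∀ i j, DiffContOnCl ℂ (fun l => G l i j) (Metric.ball 0 1)) ∧
    (∀ l : Circle, G l = g l) ∧
    (∀ l ∈ Metric.ball (0 : ℂ) 1, (G l).det = 1) ∧
    ∃ r : ℝ, 0 < r ∧ G 0 = !![(r : ℂ), 0; 0, (r : ℂ)⁻¹]

/-- `F` is the extended framing generated by the potential `ξ dz`: for every `z`, the loop
`F z` is the unitary factor of the Iwasawa decomposition of `exp (z ξ)`. -/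
def IsExtendedFraming (ξ : ℂ → Matrix (Fin 2) (Fin 2) ℂ)
    (F : ℂ → Circle → Matrix (Fin 2) (Fin 2) ℂ) : Prop :=
  ∀ z : ℂ, IsUnitaryLoop (F z) ∧ ∃ B : Circle → Matrix (Fin 2) (Fin 2) ℂ,
    IsPositiveLoop B ∧ ∀ l : Circle, NormedSpace.exp (z • ξ l) = F z l * B l

/-! ### The Delaunay data

Throughout, `a`, `b` are the constants of the potential, `H` is the mean curvature, and `l`
is the loop parameter. -/

/-- The coefficient `ξ` of the potential `ξ dz` in normal form with constants `a`, `b`. -/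
def xi (a b : ℝ) (l : ℂ) : Matrix (Fin 2) (Fin 2) ℂ :=
  Complex.I • !![0, a * l⁻¹ + b * l; b * l⁻¹ + a * l, 0]

/-- The square root `v₀(y) = 2 b H⁻¹ dn(2 b y | κ')` of the conformal factor, where
`κ' = 1 - a² / b²`. -/
def v0 (a b H y : ℝ) : ℝ :=
  2 * b * H⁻¹ * jacobiDn (2 * b * y) (1 - a ^ 2 / b ^ 2)

/-- The coefficient `Q` of the Hopf differential. -/
def hopf (a b H : ℝ) : ℝ := 2 * a * b * H⁻¹

/-- The `dx`-part of the Maurer-Cartan form with conformal factor `v₀²`, Hopf differential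
`λ⁻² Q dz²` and mean curvature `H`. -/
def alpha1 (a b H y : ℝ) (l : ℂ) : Matrix (Fin 2) (Fin 2) ℂ :=
  let v : ℂ := v0 a b H y
  let v' : ℂ := (deriv (v0 a b H) y : ℝ)
  let Q : ℂ := hopf a b H
  (Complex.I / 2) • !![v' * v⁻¹, 2 * v⁻¹ * l⁻¹ * Q + v * l * H;
    v * l⁻¹ * H + 2 * v⁻¹ * l * Q, -(v' * v⁻¹)]

/-- The `dy`-part of that Maurer-Cartan form. -/
def alpha2 (a b H y : ℝ) (l : ℂ) : Matrix (Fin 2) (Fin 2) ℂ :=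
  let v : ℂ := v0 a b H y
  let Q : ℂ := hopf a b H
  (1 / 2 : ℂ) • !![0, -(2 * v⁻¹ * l⁻¹ * Q) + v * l * H;
    -(v * l⁻¹ * H) + 2 * v⁻¹ * l * Q, 0]

/-- The lower left entry `ω` of `ξ`. -/
def omega (a b : ℝ) (l : ℂ) : ℂ := Complex.I * b * l⁻¹ + Complex.I * a * l

/-- The lower left entry `Ω₁` of `α₁`. -/
def Omega1 (a b H y : ℝ) (l : ℂ) : ℂ :=
  Complex.I / 2 * v0 a b H y * H * l⁻¹ + 2 * Complex.I * (v0 a b H y : ℂ)⁻¹ * a * b * (H : ℂ)⁻¹ * l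

/-- The branch of `√(ω Ω₁)` used in `T`: it is `ω` times the principal square root of
`Ω₁ / ω`. At `y = 0` it equals `ω`, and it is continuous in `y` as long as `Ω₁ / ω` stays off
the half-line `(-∞, 0]`. -/
def sqrtOmega (a b H y : ℝ) (l : ℂ) : ℂ :=
  omega a b l * (Omega1 a b H y l / omega a b l) ^ (1 / 2 : ℂ)

/-- The upper triangular matrix `T(y, λ)`. -/
def T (a b H y : ℝ) (l : ℂ) : Matrix (Fin 2) (Fin 2) ℂ :=
  (sqrtOmega a b H y l)⁻¹ •
    !![Omega1 a b H y l, -(Complex.I / 2) * (v0 a b H y : ℂ)⁻¹ * (deriv (v0 a b H) y : ℝ);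
      0, omega a b l]

/-- The integrand `8 a b λ / (4 i a b λ + i H² λ⁻¹ v₀²)` in the definition of `f`. -/
def integrand (a b H : ℝ) (l : ℂ) (ζ : ℝ) : ℂ :=
  8 * a * b * l /
    (4 * Complex.I * a * b * l + Complex.I * (H : ℂ) ^ 2 * l⁻¹ * (v0 a b H ζ : ℂ) ^ 2)

/-- The function `𝐟(x, y, λ) = x + i y + f(y, λ)`, where `f` is the integral of `integrand`
from `0` to `y`. -/
def boldf (a b H x y : ℝ) (l : ℂ) : ℂ :=
  x + Complex.I * y + ∫ ζ in (0 : ℝ)..y, integrand a b H l ζ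

end

end DelaunayFrame

namespace DelaunayFrame

/-! ### The derivative of the delta amplitude -/

/-! Let d(y) = dn(2by | 1 - a²/b²) and e = d'. In terms of d and e the forms α₁, α₂ no longer
involve H, α₁ at y = 0 is ξ, and the differential equations for d amount to the Lax equation α₁' =
[α₁, α₂] (`hasEntryDerivAt_formX`). Up to a constant, iα₁ - α₂ is the dz̄-part of the form, and it
is polynomial in λ. So the solution of B' = (iα₁ - α₂)B, B(0) = 1, is entire in λ; at λ = 0 it is
diag(r, 1/r) with r > 0 (`exists_positiveFactor`). The Lax equation makes B⁻¹α₁B constant, hence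
equal to ξ. For F = exp(zξ)B⁻¹ this gives F⁻¹F_x = α₁ and F⁻¹F_y = iα₁ - (iα₁ - α₂) = α₂. Since ξ
and α₂ are skew-Hermitian on the circle, F is unitary, and exp(zξ) = FB is the Iwasawa decomposition
(`exists_extendedFraming`). It is unique by the maximum principle (`IsExtendedFraming.unique`). For
the explicit formula, Tα₂ - T' = (i + f')ξT (`hasEntryDerivAt_T`). Hence exp(𝐟ξ)T solves R' = Rα₂,
R(0) = 1 on the line x = 0, as F does, and the two agree (`eq_exp_mul_T`); in x both are translated
by exp(xξ) from the left. The principal root in T is differentiable because Ω₁/ω starts at 1 and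
cannot reach (-∞, 0] unless Ω₁ vanishes on the way (`Omega1_div_omega_mem_slitPlane`). -/

theorem one_sub_mul_sin_sq_pos {m : ℝ} (hm : m < 1) (t : ℝ) : 0 < 1 - m * Real.sin t ^ 2 := by
  have h0 := sq_nonneg (Real.sin t)
  have h1 := Real.sin_sq_le_one t
  rcases le_total m 0 with h | h <;> nlinarith

theorem hasDerivAt_ellipticF {m : ℝ} (hm : m < 1) (φ : ℝ) :
    HasDerivAt (fun φ => ellipticF φ m) (1 / Real.sqrt (1 - m * Real.sin φ ^ 2)) φ := by
  have hcont : Continuous (fun t : ℝ => 1 / Real.sqrt (1 - m * Real.sin t ^ 2)) :=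
    Continuous.div continuous_const (by fun_prop)
      fun t => (Real.sqrt_pos.2 (one_sub_mul_sin_sq_pos hm t)).ne'
  exact intervalIntegral.integral_hasDerivAt_right (hcont.intervalIntegrable _ _)
      (hcont.stronglyMeasurableAtFilter _ _) hcont.continuousAt

theorem strictMono_ellipticF {m : ℝ} (hm : m < 1) : StrictMono (fun φ => ellipticF φ m) := by
  refine strictMono_of_deriv_pos fun φ => ?_
  rw [(hasDerivAt_ellipticF hm φ).deriv]
  exact one_div_pos.2 (Real.sqrt_pos.2 (one_sub_mul_sin_sq_pos hm φ))

theorem ellipticF_amplitude {m : ℝ} (hm : m < 1) (u : ℝ) : ellipticF (amplitude u m) m = u :=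
  Function.rightInverse_invFun (ellipticF_bijective hm).2 u

theorem amplitude_ellipticF {m : ℝ} (hm : m < 1) (φ : ℝ) : amplitude (ellipticF φ m) m = φ :=
  Function.leftInverse_invFun (ellipticF_bijective hm).1 φ

/-- A monotone surjection of the line is continuous. The inverse function rule for the amplitude
needs this continuity as input. -/
theorem continuous_amplitude {m : ℝ} (hm : m < 1) : Continuous (fun u => amplitude u m) := by
  refine Monotone.continuous_of_surjective (fun u v huv => ?_)
    fun φ => ⟨ellipticF φ m, amplitude_ellipticF hm φ⟩
  rw [← (strictMono_ellipticF hm).le_iff_le]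
  simpa only [ellipticF_amplitude hm] using huv

theorem hasDerivAt_amplitude {m : ℝ} (hm : m < 1) (u : ℝ) :
    HasDerivAt (fun u => amplitude u m) (jacobiDn u m) u := by
  have hpos := Real.sqrt_pos.2 (one_sub_mul_sin_sq_pos hm (amplitude u m))
  have h := HasDerivAt.of_local_left_inverse (continuous_amplitude hm).continuousAt
    (hasDerivAt_ellipticF hm (amplitude u m)) (one_div_pos.2 hpos).ne'
    (Filter.Eventually.of_forall (ellipticF_amplitude hm))
  simpa [jacobiDn] using h

theorem jacobiDn_pos {m : ℝ} (hm : m < 1) (u : ℝ) : 0 < jacobiDn u m :=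
  Real.sqrt_pos.2 (one_sub_mul_sin_sq_pos hm _)

theorem jacobiDn_sq {m : ℝ} (hm : m < 1) (u : ℝ) :
    jacobiDn u m ^ 2 = 1 - m * Real.sin (amplitude u m) ^ 2 :=
  Real.sq_sqrt (one_sub_mul_sin_sq_pos hm _).le

theorem amplitude_zero {m : ℝ} (hm : m < 1) : amplitude 0 m = 0 := by
  simpa [ellipticF] using amplitude_ellipticF hm 0

theorem hasDerivAt_jacobiDn {m : ℝ} (hm : m < 1) (u : ℝ) :
    HasDerivAt (fun u => jacobiDn u m)
      (-m * Real.sin (amplitude u m) * Real.cos (amplitude u m)) u := by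
  have h := ((((hasDerivAt_amplitude hm u).sin.pow 2).const_mul m).const_sub 1).sqrt
    (one_sub_mul_sin_sq_pos hm (amplitude u m)).ne'
  refine h.congr_deriv ?_
  have hd := (jacobiDn_pos hm u).ne'
  have : Real.sqrt (1 - m * Real.sin (amplitude u m) ^ 2) = jacobiDn u m := rfl
  simp only [Pi.pow_apply, this]
  field_simp
  ring

/-- The differential equations satisfied by the profile `d(y) = dn(2 b y | 1 - a² / b²)` and its
derivative `e`. -/
structure IsProfile (a b : ℝ) (d e : ℝ → ℝ) : Prop where
  zero : d 0 = 1
  deriv_zero : e 0 = 0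
  pos : ∀ y, 0 < d y
  hasDerivAt : ∀ y, HasDerivAt d (e y) y
  hasDerivAt' : ∀ y, HasDerivAt e (-8 * b ^ 2 * d y ^ 3 + 4 * (a ^ 2 + b ^ 2) * d y) y
  energy : ∀ y, e y ^ 2 = -4 * b ^ 2 * d y ^ 4 + 4 * (a ^ 2 + b ^ 2) * d y ^ 2 - 4 * a ^ 2

/-- Elliptic functions end here: everything later uses only the equations of the profile. The
parameter enters through b²m = b² - a². -/
theorem exists_isProfile {a b : ℝ} (ha : a ≠ 0) (hb : b ≠ 0) :
    ∃ d e : ℝ → ℝ, IsProfile a b d e ∧ ∀ H y, v0 a b H y = 2 * b * H⁻¹ * d y := by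
  have hm : 1 - a ^ 2 / b ^ 2 < 1 := by
    have : 0 < a ^ 2 / b ^ 2 := by positivity
    linarith
  obtain ⟨m, hmdef⟩ : ∃ m, m = 1 - a ^ 2 / b ^ 2 := ⟨_, rfl⟩
  have hmb : b ^ 2 * m = b ^ 2 - a ^ 2 := by rw [hmdef]; field_simp
  rw [← hmdef] at hm
  have hlin : ∀ y : ℝ, HasDerivAt (fun y => 2 * b * y) (2 * b) y := fun y => by
    simpa using (hasDerivAt_id y).const_mul (2 * b)
  refine ⟨fun y => jacobiDn (2 * b * y) m, fun y =>
    (-m * Real.sin (amplitude (2 * b * y) m) * Real.cos (amplitude (2 * b * y) m)) * (2 * b),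
    ⟨?_, ?_, fun y => jacobiDn_pos hm _, fun y => ?_, fun y => ?_, fun y => ?_⟩, fun H y => ?_⟩
  · simp [jacobiDn, amplitude_zero hm]
  · simp [amplitude_zero hm]
  · exact (hasDerivAt_jacobiDn hm (2 * b * y)).comp y (hlin y)
  · have hA := (hasDerivAt_amplitude hm (2 * b * y)).comp y (hlin y)
    have h := ((hA.sin.const_mul (-m)).mul hA.cos).mul_const (2 * b)
    refine h.congr_deriv ?_
    have h1 := jacobiDn_sq hm (2 * b * y)
    have h2 := Real.sin_sq_add_cos_sq (amplitude (2 * b * y) m)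
    simp only [Function.comp]
    generalize jacobiDn (2 * b * y) m = d at *
    generalize Real.sin (amplitude (2 * b * y) m) = s at *
    generalize Real.cos (amplitude (2 * b * y) m) = c at *
    linear_combination (-4 * b ^ 2 * m * d) * h2 + 8 * b ^ 2 * d * h1 - 4 * d * hmb
  · have h1 := jacobiDn_sq hm (2 * b * y)
    have h2 := Real.sin_sq_add_cos_sq (amplitude (2 * b * y) m)
    generalize jacobiDn (2 * b * y) m = d at *
    generalize Real.sin (amplitude (2 * b * y) m) = s at *
    generalize Real.cos (amplitude (2 * b * y) m) = c at *
    have h3 : m * s ^ 2 = 1 - d ^ 2 := by linarith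
    have h4 : m * c ^ 2 = m - 1 + d ^ 2 := by linear_combination m * h2 - h3
    linear_combination 4 * b ^ 2 * (m * c ^ 2) * h3 + 4 * b ^ 2 * (1 - d ^ 2) * h4 +
      4 * (1 - d ^ 2) * hmb
  · simp only [v0, hmdef]

end DelaunayFrame

namespace DelaunayFrame

/-! ### Linear differential equations with a holomorphic parameter -/

section ParameterODE

variable {A : Type*} [NormedRing A] [NormedAlgebra ℂ A]

/-- The iterated integrals of `N`, the coefficients in the power series expansion in `l` of the
solution of `E' = l N E`, `E(0) = 1`. -/
noncomputable def iteratedIntegral (N : ℝ → A) : ℕ → ℝ → A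
  | 0, _ => 1
  | n + 1, y => ∫ s in (0 : ℝ)..y, N s * iteratedIntegral N n s

theorem continuous_iteratedIntegral {N : ℝ → A} (hN : Continuous N) (n : ℕ) :
    Continuous (iteratedIntegral N n) := by
  induction n with
  | zero => exact continuous_const
  | succ n ih =>
    exact intervalIntegral.continuous_primitive
      (fun _ _ => (hN.mul ih).intervalIntegrable _ _) 0

theorem hasDerivAt_iteratedIntegral_succ [CompleteSpace A] {N : ℝ → A} (hN : Continuous N) (n : ℕ)
    (y : ℝ) : HasDerivAt (iteratedIntegral N (n + 1)) (N y * iteratedIntegral N n y) y :=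
  have hc := hN.mul (continuous_iteratedIntegral hN n)
  intervalIntegral.integral_hasDerivAt_right (hc.intervalIntegrable _ _)
    (hc.stronglyMeasurableAtFilter _ _) hc.continuousAt

/-- The n-fold integral runs over a simplex, whence the factorial. The factor ‖1‖ stays because the
unit need not have norm one. -/
theorem norm_iteratedIntegral_le {N : ℝ → A} (hN : Continuous N) {R K : ℝ} (hK : 0 ≤ K)
    (hNK : ∀ s, |s| ≤ R → ‖N s‖ ≤ K) (n : ℕ) {y : ℝ} (hy : |y| ≤ R) :
    ‖iteratedIntegral N n y‖ ≤ ‖(1 : A)‖ * ((K * |y|) ^ n / n.factorial) := by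
  induction n generalizing y with
  | zero => simp [iteratedIntegral]
  | succ n ih =>
    have hc := hN.mul (continuous_iteratedIntegral hN n)
    have hsub : ∀ s ∈ Set.uIoc 0 y, |s| ≤ R := by
      intro s hs
      have h := Set.uIoc_subset_uIcc hs
      have := Set.abs_sub_left_of_mem_uIcc h
      simp only [sub_zero] at this
      exact this.trans hy
    calc ‖iteratedIntegral N (n + 1) y‖
        ≤ ∫ s in Set.uIoc 0 y, ‖N s * iteratedIntegral N n s‖ :=
          intervalIntegral.norm_integral_le_integral_norm_uIoc
      _ ≤ ∫ s in Set.uIoc 0 y, ‖(1 : A)‖ * K ^ (n + 1) / n.factorial * |s - 0| ^ n := by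
          refine MeasureTheory.setIntegral_mono_on ?_ ?_ measurableSet_uIoc fun s hs => ?_
          · exact (hc.norm.intervalIntegrable 0 y).def'
          · exact ((by fun_prop : Continuous fun s : ℝ =>
              ‖(1 : A)‖ * K ^ (n + 1) / n.factorial * |s - 0| ^ n).intervalIntegrable 0 y).def'
          · calc ‖N s * iteratedIntegral N n s‖ ≤ ‖N s‖ * ‖iteratedIntegral N n s‖ :=
                  norm_mul_le _ _
              _ ≤ K * (‖(1 : A)‖ * ((K * |s|) ^ n / n.factorial)) :=
                  mul_le_mul (hNK s (hsub s hs)) (ih (hsub s hs)) (norm_nonneg _) hK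
              _ = _ := by rw [sub_zero, mul_pow]; ring
      _ = _ := by
          rw [MeasureTheory.integral_const_mul, integral_pow_abs_sub_uIoc, Nat.factorial_succ,
            sub_zero, mul_pow]
          have : (n.factorial : ℝ) ≠ 0 := by positivity
          push_cast
          field_simp

/-- The Picard series is a power series in l whose coefficients do not depend on l. The factorial
bound allows termwise differentiation both in y and in l, so existence and holomorphy come together.
-/
theorem exists_linear_ode_family [CompleteSpace A]
    {N : ℝ → A} (hN : Continuous N) :
    ∃ E : ℂ → ℝ → A, (∀ l, E l 0 = 1) ∧ (∀ y, E 0 y = 1) ∧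
      (∀ l y, HasDerivAt (E l) (l • (N y * E l y)) y) ∧
      ∀ y, Differentiable ℂ (fun l => E l y) := by
  have hbound : ∀ R : ℝ, ∃ K, 0 ≤ K ∧ ∀ s, |s| ≤ R → ‖N s‖ ≤ K := by
    intro R
    obtain ⟨K, hK⟩ := (isCompact_Icc (a := -R) (b := R)).exists_bound_of_continuousOn
      hN.continuousOn
    exact ⟨max K 0, le_max_right _ _, fun s hs => (hK s (abs_le.1 hs)).trans (le_max_left _ _)⟩
  have hiter : ∀ R K : ℝ, 0 ≤ R → 0 ≤ K → (∀ s, |s| ≤ R → ‖N s‖ ≤ K) → ∀ n y, |y| ≤ R →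
      ‖iteratedIntegral N n y‖ ≤ ‖(1 : A)‖ * ((K * R) ^ n / n.factorial) := by
    intro R K hR hK hNK n y hy
    refine (norm_iteratedIntegral_le hN hK hNK n hy).trans ?_
    gcongr
  have hsummable : ∀ c ρ : ℝ, Summable fun n : ℕ => c * (ρ ^ n / n.factorial) := fun c ρ =>
    (Real.summable_pow_div_factorial ρ).mul_left c
  have hterm : ∀ R K ρ : ℝ, 0 ≤ R → 0 ≤ K → (∀ s, |s| ≤ R → ‖N s‖ ≤ K) → ∀ n y, |y| ≤ R →
      ∀ l : ℂ, ‖l‖ ≤ ρ →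
      ‖l ^ n • iteratedIntegral N n y‖ ≤ ‖(1 : A)‖ * ((ρ * K * R) ^ n / n.factorial) := by
    intro R K ρ hR hK hNK n y hy l hl
    rw [norm_smul, norm_pow]
    calc ‖l‖ ^ n * ‖iteratedIntegral N n y‖
        ≤ ρ ^ n * (‖(1 : A)‖ * ((K * R) ^ n / n.factorial)) := by
          have hρ : 0 ≤ ρ := (norm_nonneg l).trans hl
          gcongr
          exact hiter R K hR hK hNK n y hy
      _ = _ := by rw [mul_assoc ρ, mul_pow ρ]; ring
  have hsum : ∀ (l : ℂ) (y : ℝ), Summable fun n => l ^ n • iteratedIntegral N n y := by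
    intro l y
    obtain ⟨K, hK, hNK⟩ := hbound |y|
    exact Summable.of_norm_bounded (hsummable _ _)
      fun n => hterm _ K ‖l‖ (abs_nonneg y) hK hNK n y le_rfl l le_rfl
  refine ⟨fun l y => ∑' n, l ^ n • iteratedIntegral N n y, fun l => ?_, fun y => ?_,
    fun l y => ?_, fun y => ?_⟩
  · beta_reduce
    rw [tsum_eq_single 0]
    · simp [iteratedIntegral]
    · rintro (_ | n) hn
      · exact absurd rfl hn
      · simp [iteratedIntegral]
  · beta_reduce
    rw [tsum_eq_single 0]
    · simp [iteratedIntegral]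
    · intro n hn
      simp [hn]
  · obtain ⟨K, hK, hNK⟩ := hbound (|y| + 1)
    have hR : 0 ≤ |y| + 1 := by positivity
    -- The zeroth term is constant in y, so the derived series starts one index later; the shift
    -- produces the factor l N(y).
    set g' : ℕ → ℝ → A := fun n y => match n with
      | 0 => 0
      | n + 1 => l ^ (n + 1) • (N y * iteratedIntegral N n y) with hg'
    set u : ℕ → ℝ := fun n => match n with
      | 0 => 0
      | n + 1 => ‖l‖ * K * (‖(1 : A)‖ * ((‖l‖ * K * (|y| + 1)) ^ n / n.factorial)) with hu
    have hus : Summable u := (summable_nat_add_iff 1).1 ((hsummable _ _).mul_left _)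
    have hder : ∀ n s, HasDerivAt (fun s => l ^ n • iteratedIntegral N n s) (g' n s) s := by
      rintro (_ | n) s
      · simpa [hg', iteratedIntegral] using hasDerivAt_const s (1 : A)
      · exact (hasDerivAt_iteratedIntegral_succ hN n s).const_smul (l ^ (n + 1))
    have hle : ∀ n s, s ∈ Metric.ball (0 : ℝ) (|y| + 1) → ‖g' n s‖ ≤ u n := by
      rintro (_ | n) s hs
      · simp [hg', hu]
      · have hs' : |s| ≤ |y| + 1 := by simpa using (mem_ball_zero_iff.1 hs).le
        calc ‖l ^ (n + 1) • (N s * iteratedIntegral N n s)‖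
            = ‖l‖ * ‖N s * (l ^ n • iteratedIntegral N n s)‖ := by
              rw [mul_smul_comm, ← norm_smul, smul_smul, pow_succ']
          _ ≤ ‖l‖ * (K * (‖(1 : A)‖ * ((‖l‖ * K * (|y| + 1)) ^ n / n.factorial))) := by
              gcongr
              exact (norm_mul_le _ _).trans (mul_le_mul (hNK s hs')
                (hterm _ K ‖l‖ hR hK hNK n s hs' l le_rfl) (norm_nonneg _) hK)
          _ = _ := by rw [hu]; ring
    have h := hasDerivAt_tsum_of_isPreconnected hus Metric.isOpen_ball
      (convex_ball (0 : ℝ) (|y| + 1)).isPreconnected (fun n s _ => hder n s) hle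
      (Metric.mem_ball_self (by positivity)) (hsum l 0)
      (show y ∈ Metric.ball (0 : ℝ) (|y| + 1) by simp)
    refine h.congr_deriv ?_
    have hs' : Summable fun n => g' n y := Summable.of_norm_bounded hus
      fun n => hle n y (by simp)
    rw [hs'.tsum_eq_zero_add]
    have hs'' := hsum l y
    rw [← hs''.tsum_mul_left, ← (hs''.mul_left (N y)).tsum_const_smul]
    simp only [hg', zero_add]
    refine tsum_congr fun n => ?_
    rw [mul_smul_comm, smul_smul, pow_succ']
  · intro l
    obtain ⟨K, hK, hNK⟩ := hbound |y|
    have h := Complex.differentiableOn_tsum_of_summable_norm (hsummable ‖(1 : A)‖ ((‖l‖ + 1) * K * |y|))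
      (F := fun n (w : ℂ) => w ^ n • iteratedIntegral N n y) (U := Metric.ball 0 (‖l‖ + 1))
      (fun n => by fun_prop) Metric.isOpen_ball
      (fun n w hw => hterm _ K (‖l‖ + 1) (abs_nonneg y) hK hNK n y le_rfl w
        (mem_ball_zero_iff.1 hw).le)
    exact h.differentiableAt (Metric.isOpen_ball.mem_nhds (by simp))

end ParameterODE

end DelaunayFrame

namespace DelaunayFrame

open Matrix

/-! ### Entrywise derivatives of `2 × 2` matrices -/

section EntryDeriv

/-- The entrywise derivative of a curve of matrices. -/
def HasEntryDerivAt (M : ℝ → Matrix (Fin 2) (Fin 2) ℂ) (M' : Matrix (Fin 2) (Fin 2) ℂ)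
    (y : ℝ) : Prop :=
  ∀ i j, HasDerivAt (fun t => M t i j) (M' i j) y

variable {X Y : ℝ → Matrix (Fin 2) (Fin 2) ℂ} {X' Y' : Matrix (Fin 2) (Fin 2) ℂ} {y : ℝ}

theorem HasEntryDerivAt.mul (hX : HasEntryDerivAt X X' y) (hY : HasEntryDerivAt Y Y' y) :
    HasEntryDerivAt (fun t => X t * Y t) (X' * Y y + X y * Y') y := by
  intro i j
  have h := ((hX i 0).mul (hY 0 j)).add ((hX i 1).mul (hY 1 j))
  simp only [Matrix.mul_apply, Fin.sum_univ_two, Matrix.add_apply]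
  exact h.congr_deriv (by ring)

theorem hasEntryDerivAt_const (M : Matrix (Fin 2) (Fin 2) ℂ) (y : ℝ) :
    HasEntryDerivAt (fun _ => M) 0 y :=
  fun _ _ => hasDerivAt_const y _

theorem HasEntryDerivAt.const_mul (M : Matrix (Fin 2) (Fin 2) ℂ) (hX : HasEntryDerivAt X X' y) :
    HasEntryDerivAt (fun t => M * X t) (M * X') y := by
  simpa using (hasEntryDerivAt_const M y).mul hX

theorem HasEntryDerivAt.mul_const (hX : HasEntryDerivAt X X' y) (M : Matrix (Fin 2) (Fin 2) ℂ) :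
    HasEntryDerivAt (fun t => X t * M) (X' * M) y := by
  simpa using hX.mul (hasEntryDerivAt_const M y)

/-- For 2 × 2 matrices the adjugate is linear in the entries. It serves as the inverse throughout,
and can be differentiated before the determinant is known to be 1. -/
theorem HasEntryDerivAt.adjugate (hX : HasEntryDerivAt X X' y) :
    HasEntryDerivAt (fun t => (X t).adjugate) X'.adjugate y := by
  intro i j
  simp only [Matrix.adjugate_fin_two]
  fin_cases i <;> fin_cases j
  · exact hX 1 1
  · exact (hX 0 1).neg
  · exact (hX 1 0).neg
  · exact hX 0 0

theorem HasEntryDerivAt.conjTranspose (hX : HasEntryDerivAt X X' y) :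
    HasEntryDerivAt (fun t => (X t)ᴴ) X'ᴴ y :=
  fun i j => (hX j i).star

/-- The hypothesis is confined to the segment from 0 to y because T is controlled only while Ω₁ has
no zero there. -/
theorem eq_of_hasEntryDerivAt_zero (h : ∀ t ∈ Set.uIcc 0 y, HasEntryDerivAt X 0 t) :
    X y = X 0 := by
  rcases eq_or_ne y 0 with rfl | hy
  · rfl
  ext i j
  have h' := (convex_uIcc 0 y).is_const_of_fderivWithin_eq_zero (𝕜 := ℝ)
    (f := fun t => X t i j) (fun t ht => (h t ht i j).differentiableAt.differentiableWithinAt)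
    (fun t ht => by
      have hu : UniqueDiffOn ℝ (Set.uIcc 0 y) := uniqueDiffOn_Icc (inf_lt_sup.2 hy.symm)
      refine ((h t ht i j).hasFDerivAt.hasFDerivWithinAt.fderivWithin (hu t ht)).trans ?_
      ext
      simp)
    Set.right_mem_uIcc Set.left_mem_uIcc
  exact h'

theorem adjugate_add_self_of_trace_eq_zero {M : Matrix (Fin 2) (Fin 2) ℂ} (hM : M.trace = 0) :
    M.adjugate + M = 0 := by
  rw [Matrix.trace_fin_two] at hM
  rw [Matrix.adjugate_fin_two]
  ext i j
  fin_cases i <;> fin_cases j <;> simp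
  · linear_combination hM
  · linear_combination hM

theorem adjugate_eq_neg_of_trace_eq_zero {M : Matrix (Fin 2) (Fin 2) ℂ} (hM : M.trace = 0) :
    M.adjugate = -M :=
  eq_neg_of_add_eq_zero_left (adjugate_add_self_of_trace_eq_zero hM)

/-- Two solutions of a trace free linear differential equation `X' = C X`. -/
theorem adjugate_mul_eq_of_deriv {C : ℝ → Matrix (Fin 2) (Fin 2) ℂ}
    (hC : ∀ t, (C t).trace = 0) (hX : ∀ t, HasEntryDerivAt X (C t * X t) t)
    (hY : ∀ t, HasEntryDerivAt Y (C t * Y t) t) (y : ℝ) :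
    (X y).adjugate * Y y = (X 0).adjugate * Y 0 := by
  refine eq_of_hasEntryDerivAt_zero (X := fun t => (X t).adjugate * Y t) fun t _ => ?_
  have h := (hX t).adjugate.mul (hY t)
  -- For trace free C the adjugate is -C, so adj(X) solves Z' = -ZC and the two terms of the product
  -- rule cancel.
  rw [Matrix.adjugate_mul_distrib, adjugate_eq_neg_of_trace_eq_zero (hC t)] at h
  simpa [Matrix.mul_assoc] using h

/-- Liouville's formula: take both solutions equal and use adj(X) X = det(X) · 1. -/
theorem det_eq_one_of_deriv {C : ℝ → Matrix (Fin 2) (Fin 2) ℂ}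
    (hC : ∀ t, (C t).trace = 0) (hX : ∀ t, HasEntryDerivAt X (C t * X t) t) (h0 : X 0 = 1)
    (y : ℝ) : (X y).det = 1 := by
  have h := adjugate_mul_eq_of_deriv hC hX hX y
  rw [Matrix.adjugate_mul, Matrix.adjugate_mul, h0] at h
  simpa using congrFun (congrFun h 0) 0

theorem eq_of_deriv {C : ℝ → Matrix (Fin 2) (Fin 2) ℂ}
    (hC : ∀ t, (C t).trace = 0) (hX : ∀ t, HasEntryDerivAt X (C t * X t) t)
    (hY : ∀ t, HasEntryDerivAt Y (C t * Y t) t) (hX0 : X 0 = 1) (hY0 : Y 0 = 1) (y : ℝ) :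
    Y y = X y := by
  have h := adjugate_mul_eq_of_deriv hC hX hY y
  rw [hX0, hY0, Matrix.adjugate_one, Matrix.mul_one] at h
  calc Y y = X y * ((X y).adjugate * Y y) := by
        rw [← Matrix.mul_assoc, Matrix.mul_adjugate, det_eq_one_of_deriv hC hX hX0]; simp
    _ = X y := by rw [h, Matrix.mul_one]

/-- Two solutions of a skew-Hermitian linear differential equation `X' = X A`. -/
theorem mul_conjTranspose_eq_of_deriv {A : ℝ → Matrix (Fin 2) (Fin 2) ℂ}
    (hA : ∀ t, (A t)ᴴ = -A t) (hX : ∀ t ∈ Set.uIcc 0 y, HasEntryDerivAt X (X t * A t) t)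
    (hY : ∀ t ∈ Set.uIcc 0 y, HasEntryDerivAt Y (Y t * A t) t) :
    X y * (Y y)ᴴ = X 0 * (Y 0)ᴴ := by
  refine eq_of_hasEntryDerivAt_zero (X := fun t => X t * (Y t)ᴴ) fun t ht => ?_
  have h := (hX t ht).mul (hY t ht).conjTranspose
  rw [Matrix.conjTranspose_mul, hA t] at h
  simpa [Matrix.mul_assoc] using h

end EntryDeriv

/-! ### Matrix exponentials and the parameter family for 2 × 2 matrices -/

section MatrixNorm

attribute [local instance] Matrix.linftyOpNormedRing Matrix.linftyOpNormedAlgebra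

/-- The entries of a matrix as continuous linear functionals. -/
noncomputable def entryCLM (i j : Fin 2) : Matrix (Fin 2) (Fin 2) ℂ →L[ℂ] ℂ :=
  LinearMap.toContinuousLinearMap
    { toFun := fun M => M i j, map_add' := fun _ _ => rfl, map_smul' := fun _ _ => rfl }

theorem hasEntryDerivAt_exp_smul (M : Matrix (Fin 2) (Fin 2) ℂ) {w : ℝ → ℂ} {w' : ℂ} {y : ℝ}
    (hw : HasDerivAt w w' y) :
    HasEntryDerivAt (fun t => NormedSpace.exp (w t • M))
      (w' • (M * NormedSpace.exp (w y • M))) y := by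
  intro i j
  have h1 := hasDerivAt_exp_smul_const' (𝕂 := ℂ) M (w y)
  have h2 := (entryCLM i j).hasFDerivAt.comp_hasDerivAt (w y) h1
  have h3 := HasDerivAt.comp_of_eq y h2 hw rfl
  exact h3.congr_deriv (mul_comm _ w')

theorem commute_exp_smul (M : Matrix (Fin 2) (Fin 2) ℂ) (w : ℂ) :
    M * NormedSpace.exp (w • M) = NormedSpace.exp (w • M) * M :=
  (((Commute.refl M).smul_right w).exp_right).eq

theorem exp_add_smul (M : Matrix (Fin 2) (Fin 2) ℂ) (w₁ w₂ : ℂ) :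
    NormedSpace.exp ((w₁ + w₂) • M) = NormedSpace.exp (w₁ • M) * NormedSpace.exp (w₂ • M) := by
  rw [add_smul]
  exact NormedSpace.exp_add_of_commute (((Commute.refl M).smul_right _).smul_left _)

theorem contDiff_exp_entry (M₁ M₂ : Matrix (Fin 2) (Fin 2) ℂ) {w₁ w₂ : ℝ → ℂ}
    (h₁ : ContDiff ℝ ((⊤ : ℕ∞) : WithTop ℕ∞) w₁) (h₂ : ContDiff ℝ ((⊤ : ℕ∞) : WithTop ℕ∞) w₂)
    (i j : Fin 2) : ContDiff ℝ ((⊤ : ℕ∞) : WithTop ℕ∞)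
      (fun t => NormedSpace.exp (w₁ t • M₁ + w₂ t • M₂) i j) := by
  have hexp : ContDiff ℂ ((⊤ : ℕ∞) : WithTop ℕ∞)
      (NormedSpace.exp : Matrix (Fin 2) (Fin 2) ℂ → Matrix (Fin 2) (Fin 2) ℂ) :=
    contDiff_iff_contDiffAt.2 fun M => (NormedSpace.exp_analytic (𝕂 := ℂ) M).contDiffAt
  have h2 := ((entryCLM i j).contDiff.comp hexp).restrict_scalars ℝ
  have h3 : ContDiff ℝ ((⊤ : ℕ∞) : WithTop ℕ∞) (fun t => w₁ t • M₁ + w₂ t • M₂) :=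
    (h₁.smul contDiff_const).add (h₂.smul contDiff_const)
  exact h2.comp h3

theorem exists_matrix_ode_family {N : ℝ → Matrix (Fin 2) (Fin 2) ℂ}
    (hN : ∀ i j, Continuous fun y => N y i j) :
    ∃ E : ℂ → ℝ → Matrix (Fin 2) (Fin 2) ℂ, (∀ l, E l 0 = 1) ∧ (∀ y, E 0 y = 1) ∧
      (∀ l y, HasEntryDerivAt (E l) (l • (N y * E l y)) y) ∧
      ∀ y i j, Differentiable ℂ (fun l => E l y i j) := by
  have hN' : Continuous N := continuous_matrix hN
  obtain ⟨E, h1, h2, h3, h4⟩ := exists_linear_ode_family hN'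
  refine ⟨E, h1, h2, fun l y i j => ?_, fun y i j => ?_⟩
  · exact ((entryCLM i j).restrictScalars ℝ).hasFDerivAt.comp_hasDerivAt y (h3 l y)
  · exact (entryCLM i j).differentiable.comp (h4 y)

end MatrixNorm

end DelaunayFrame

namespace DelaunayFrame

open Matrix

/-! ### The Maurer-Cartan form in terms of the profile -/

/-- The `dx`-part of the Maurer-Cartan form in terms of the values `d`, `e` of the profile. -/
noncomputable def formX (a b d e l : ℂ) : Matrix (Fin 2) (Fin 2) ℂ :=
  Complex.I • !![e / (2 * d), a * (d * l)⁻¹ + b * d * l; b * d * l⁻¹ + a * l / d, -(e / (2 * d))]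

/-- The `dy`-part of the Maurer-Cartan form in terms of the value `d` of the profile. -/
noncomputable def formY (a b d l : ℂ) : Matrix (Fin 2) (Fin 2) ℂ :=
  !![0, -(a * (d * l)⁻¹) + b * d * l; -(b * d * l⁻¹) + a * l / d, 0]

/-- The coefficient of the equation satisfied by the positive factor; it is polynomial in `l`. -/
noncomputable def formBar (a b d e l : ℂ) : Matrix (Fin 2) (Fin 2) ℂ :=
  !![-(e / (2 * d)), -(2 * b * d * l); -(2 * a * l / d), e / (2 * d)]

/-- Writing the form as A dz + A' dz̄, this combination is 2iA'; the terms in l⁻¹ cancel. -/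
theorem formBar_eq (a b d e l : ℂ) :
    formBar a b d e l = Complex.I • formX a b d e l - formY a b d l := by
  have hI := Complex.I_mul_I
  ext i j
  fin_cases i <;> fin_cases j <;> simp [formBar, formX, formY]
  · linear_combination -(e / (2 * d)) * hI
  · linear_combination -(a * (l⁻¹ * d⁻¹) + b * d * l) * hI
  · linear_combination -(b * d * l⁻¹ + a * l / d) * hI
  · linear_combination (e / (2 * d)) * hI

theorem trace_formBar (a b d e l : ℂ) : (formBar a b d e l).trace = 0 := by
  simp [formBar, Matrix.trace_fin_two]

theorem trace_xi (a b : ℝ) (l : ℂ) : (xi a b l).trace = 0 := by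
  simp [xi, Matrix.trace_fin_two]

theorem formX_one_zero (a b : ℝ) (l : ℂ) : formX a b 1 0 l = xi a b l := by
  simp [formX, xi]

theorem xi_neg (a b : ℝ) (l : ℂ) : xi a b (-l) = tau (xi a b l) := by
  ext i j
  fin_cases i <;> fin_cases j <;>
    simp [xi, tau, Matrix.mul_apply, Fin.sum_univ_two, Matrix.smul_apply, inv_neg] <;> ring

theorem formBar_neg (a b d e l : ℂ) : formBar a b d e (-l) = tau (formBar a b d e l) := by
  ext i j
  fin_cases i <;> fin_cases j <;>
    simp [formBar, tau, Matrix.mul_apply, Fin.sum_univ_two, neg_div]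

theorem circle_inv (l : Circle) : (l : ℂ)⁻¹ = (starRingEnd ℂ) l := by
  rw [← Circle.coe_inv, Circle.coe_inv_eq_conj]

theorem conjTranspose_formY (a b d : ℝ) (l : Circle) :
    (formY a b d l)ᴴ = -formY a b d l := by
  ext i j
  fin_cases i <;> fin_cases j <;>
    simp [formY, circle_inv] <;> ring

theorem conjTranspose_xi (a b : ℝ) (l : Circle) : (xi a b l)ᴴ = -xi a b l := by
  ext i j
  fin_cases i <;> fin_cases j <;> simp [xi, circle_inv] <;> ring

/-! ### The forms along the profile and the Lax equation -/

section Profile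

variable {a b : ℝ} {d e : ℝ → ℝ}

theorem IsProfile.ne_zero (h : IsProfile a b d e) (y : ℝ) : (d y : ℂ) ≠ 0 := by
  exact_mod_cast (h.pos y).ne'

/-- H drops out because v₀H = 2bd and v₀⁻¹Q = a/d. -/
theorem alpha1_eq {H : ℝ} (hb : b ≠ 0) (hH : H ≠ 0) (h : IsProfile a b d e)
    (hv : ∀ y, v0 a b H y = 2 * b * H⁻¹ * d y) (y : ℝ) (l : ℂ) :
    alpha1 a b H y l = formX a b (d y) (e y) l := by
  have hd := h.ne_zero y
  have hb' : (b : ℂ) ≠ 0 := by exact_mod_cast hb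
  have hH' : (H : ℂ) ≠ 0 := by exact_mod_cast hH
  have hder : deriv (v0 a b H) y = 2 * b * H⁻¹ * e y := by
    rw [funext hv]
    exact ((h.hasDerivAt y).const_mul _).deriv
  simp only [alpha1, hder, hv, formX, hopf]
  push_cast
  ext i j
  fin_cases i <;> fin_cases j <;> simp <;> field_simp

theorem alpha2_eq {H : ℝ} (hb : b ≠ 0) (hH : H ≠ 0) (h : IsProfile a b d e)
    (hv : ∀ y, v0 a b H y = 2 * b * H⁻¹ * d y) (y : ℝ) (l : ℂ) :
    alpha2 a b H y l = formY a b (d y) l := by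
  have hd := h.ne_zero y
  have hb' : (b : ℂ) ≠ 0 := by exact_mod_cast hb
  have hH' : (H : ℂ) ≠ 0 := by exact_mod_cast hH
  simp only [alpha2, hv, formY, hopf]
  push_cast
  ext i j
  fin_cases i <;> fin_cases j <;> simp <;> field_simp

theorem IsProfile.hasDerivAt_ofReal (h : IsProfile a b d e) (y : ℝ) :
    HasDerivAt (fun t => (d t : ℂ)) (e y) y :=
  (h.hasDerivAt y).ofReal_comp

theorem IsProfile.hasDerivAt_ofReal' (h : IsProfile a b d e) (y : ℝ) :
    HasDerivAt (fun t => (e t : ℂ))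
      (-8 * (b : ℂ) ^ 2 * (d y : ℂ) ^ 3 + 4 * ((a : ℂ) ^ 2 + (b : ℂ) ^ 2) * d y) y := by
  simpa using (h.hasDerivAt' y).ofReal_comp

theorem IsProfile.energy_ofReal (h : IsProfile a b d e) (y : ℝ) :
    (e y : ℂ) ^ 2 = -4 * (b : ℂ) ^ 2 * (d y : ℂ) ^ 4
      + 4 * ((a : ℂ) ^ 2 + (b : ℂ) ^ 2) * (d y : ℂ) ^ 2 - 4 * (a : ℂ) ^ 2 := by
  exact_mod_cast congrArg (fun r : ℝ => (r : ℂ)) (h.energy y)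

/-- The Maurer-Cartan equation, for a form that does not depend on `x`. -/
theorem hasEntryDerivAt_formX (h : IsProfile a b d e) {l : ℂ} (hl : l ≠ 0) (y : ℝ) :
    HasEntryDerivAt (fun t => formX a b (d t) (e t) l)
      (formX a b (d y) (e y) l * formY a b (d y) l -
        formY a b (d y) l * formX a b (d y) (e y) l) y := by
  have hd := h.ne_zero y
  have h1 := h.hasDerivAt_ofReal y
  have h2 := h.hasDerivAt_ofReal' y
  have hen := h.energy_ofReal y
  -- Only the diagonal needs the second order equation; with the energy relation the terms in a² +
  -- b² cancel.
  have hdiag : HasDerivAt (fun t => (e t : ℂ) / (2 * d t))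
      (2 * ((a : ℂ) ^ 2 / d y ^ 2 - b ^ 2 * d y ^ 2)) y := by
    refine (h2.div (h1.const_mul 2) (by simpa using hd)).congr_deriv ?_
    field_simp
    linear_combination -hen
  have h12 : HasDerivAt (fun t => (a : ℂ) * (l⁻¹ * (d t : ℂ)⁻¹) + b * d t * l)
      (e y / d y * (-(a * (d y * l)⁻¹) + b * d y * l)) y := by
    refine ((((h1.fun_inv hd).const_mul l⁻¹).const_mul (a : ℂ)).add
      ((h1.const_mul (b : ℂ)).mul_const l)).congr_deriv ?_
    field_simp
  have h21 : HasDerivAt (fun t => (b : ℂ) * d t * l⁻¹ + a * l / d t)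
      (-(e y / d y * (-(b * d y * l⁻¹) + a * l / d y))) y := by
    refine (((h1.const_mul (b : ℂ)).mul_const l⁻¹).add
      ((hasDerivAt_const y ((a : ℂ) * l)).div h1 hd)).congr_deriv ?_
    field_simp
    ring
  intro i j
  fin_cases i <;> fin_cases j <;>
    simp [formX, formY]
  · refine (hdiag.const_mul Complex.I).congr_deriv ?_
    field_simp
    ring
  · refine (h12.const_mul Complex.I).congr_deriv ?_
    field_simp
    ring
  · refine (h21.const_mul Complex.I).congr_deriv ?_
    field_simp
    ring
  · refine (hdiag.const_mul Complex.I).neg.congr_deriv ?_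
    field_simp
    ring

end Profile

end DelaunayFrame

namespace DelaunayFrame

open Matrix

/-! ### The involution -/

theorem tau_apply (M : Matrix (Fin 2) (Fin 2) ℂ) : tau M = !![M 0 0, -M 0 1; -M 1 0, M 1 1] := by
  conv_lhs => rw [tau, Matrix.eta_fin_two M]
  simp

theorem tau_one : tau 1 = 1 := by
  ext i j
  fin_cases i <;> fin_cases j <;> simp [tau_apply]

theorem tau_mul (M N : Matrix (Fin 2) (Fin 2) ℂ) : tau (M * N) = tau M * tau N := by
  ext i j
  fin_cases i <;> fin_cases j <;> simp [tau_apply, Matrix.mul_apply, Fin.sum_univ_two] <;> ring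

theorem tau_smul (c : ℂ) (M : Matrix (Fin 2) (Fin 2) ℂ) : tau (c • M) = c • tau M := by
  ext i j
  fin_cases i <;> fin_cases j <;> simp [tau_apply]

theorem tau_adjugate (M : Matrix (Fin 2) (Fin 2) ℂ) : tau M.adjugate = (tau M).adjugate := by
  ext i j
  fin_cases i <;> fin_cases j <;> simp [tau_apply, Matrix.adjugate_fin_two]

theorem HasEntryDerivAt.tau {X : ℝ → Matrix (Fin 2) (Fin 2) ℂ} {X' : Matrix (Fin 2) (Fin 2) ℂ}
    {y : ℝ} (hX : HasEntryDerivAt X X' y) :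
    HasEntryDerivAt (fun t => DelaunayFrame.tau (X t)) (DelaunayFrame.tau X') y :=
  (hX.const_mul _).mul_const _

/-! ### The exponential factor -/

/-- Determinant, twisting and unitarity of exp(zξ) are all read off from this equation in the real
time t. -/
theorem hasEntryDerivAt_exp_mul_xi (a b : ℝ) (z l : ℂ) (t : ℝ) :
    HasEntryDerivAt (fun t : ℝ => NormedSpace.exp ((t * z) • xi a b l))
      ((z • xi a b l) * NormedSpace.exp ((t * z) • xi a b l)) t := by
  rw [Matrix.smul_mul]
  exact hasEntryDerivAt_exp_smul _ (by simpa using ((hasDerivAt_id t).ofReal_comp).mul_const z)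

theorem det_exp_xi (a b : ℝ) (z l : ℂ) : (NormedSpace.exp (z • xi a b l)).det = 1 := by
  simpa using det_eq_one_of_deriv (fun _ => by rw [Matrix.trace_smul, trace_xi, smul_zero])
    (hasEntryDerivAt_exp_mul_xi a b z l) (by simp) 1

theorem exp_xi_neg (a b : ℝ) (z l : ℂ) :
    NormedSpace.exp (z • xi a b (-l)) = tau (NormedSpace.exp (z • xi a b l)) := by
  have h2 : ∀ t : ℝ, HasEntryDerivAt (fun t : ℝ => tau (NormedSpace.exp ((t * z) • xi a b l)))
      ((z • xi a b (-l)) * tau (NormedSpace.exp ((t * z) • xi a b l))) t := by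
    intro t
    have h := (hasEntryDerivAt_exp_mul_xi a b z l t).tau
    rwa [tau_mul, tau_smul, ← xi_neg] at h
  simpa using (eq_of_deriv (fun _ => by rw [Matrix.trace_smul, trace_xi, smul_zero])
    (hasEntryDerivAt_exp_mul_xi a b z (-l)) h2 (by simp) (by simp [tau_one]) 1).symm

theorem exp_xi_mul_conjTranspose (a b : ℝ) (x : ℝ) (l : Circle) :
    NormedSpace.exp ((x : ℂ) • xi a b l) * (NormedSpace.exp ((x : ℂ) • xi a b l))ᴴ = 1 := by
  have h : ∀ t : ℝ, HasEntryDerivAt (fun t : ℝ => NormedSpace.exp ((t : ℂ) • xi a b l))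
      (NormedSpace.exp ((t : ℂ) • xi a b l) * xi a b l) t := by
    intro t
    rw [← commute_exp_smul]
    simpa using hasEntryDerivAt_exp_mul_xi a b 1 l t
  simpa using mul_conjTranspose_eq_of_deriv (y := x) (fun _ => conjTranspose_xi a b l)
    (fun t _ => h t) (fun t _ => h t)

theorem isSmoothLoop_exp_xi (a b : ℝ) (z : ℂ) :
    IsSmoothLoop (fun l => NormedSpace.exp (z • xi a b l)) := by
  intro i j
  have h1 : ContDiff ℝ ((⊤ : ℕ∞) : WithTop ℕ∞) (fun t : ℝ => z * Complex.I *
      Complex.exp (-(t * Complex.I))) :=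
    contDiff_const.mul ((Complex.ofRealCLM.contDiff.mul contDiff_const).neg.cexp)
  have h2 : ContDiff ℝ ((⊤ : ℕ∞) : WithTop ℕ∞) (fun t : ℝ => z * Complex.I *
      Complex.exp (t * Complex.I)) :=
    contDiff_const.mul ((Complex.ofRealCLM.contDiff.mul contDiff_const).cexp)
  have hxi : ∀ t : ℝ, z • xi a b (Circle.exp t) =
      (z * Complex.I * Complex.exp (-(t * Complex.I))) • !![0, (a : ℂ); (b : ℂ), 0] +
        (z * Complex.I * Complex.exp (t * Complex.I)) • !![0, (b : ℂ); (a : ℂ), 0] := by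
    intro t
    ext i j
    fin_cases i <;> fin_cases j <;> simp [xi, Circle.coe_exp, Complex.exp_neg] <;> ring
  simp only [hxi]
  exact contDiff_exp_entry _ _ h1 h2 i j

/-! ### The positive factor -/

section Profile

variable {a b : ℝ} {d e : ℝ → ℝ}

/-- The gauge D = diag(d^(-1/2), d^(1/2)) absorbs the diagonal part of the coefficient, which is
free of l. What remains is l N with N off-diagonal, so B = DE with E the power series solution. At l
= 0 only D survives, so r = d^(-1/2). -/
theorem exists_positiveFactor (h : IsProfile a b d e) :
    ∃ B : ℝ → ℂ → Matrix (Fin 2) (Fin 2) ℂ, (∀ l, B 0 l = 1) ∧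
      (∀ l y, HasEntryDerivAt (fun t => B t l) (formBar a b (d y) (e y) l * B y l) y) ∧
      (∀ y i j, Differentiable ℂ (fun l => B y l i j)) ∧
      ∀ y, ∃ r : ℝ, 0 < r ∧ B y 0 = !![(r : ℂ), 0; 0, (r : ℂ)⁻¹] := by
  have hdc : Continuous d := continuous_iff_continuousAt.2 fun y => (h.hasDerivAt y).continuousAt
  set N : ℝ → Matrix (Fin 2) (Fin 2) ℂ := fun y =>
    !![0, -(2 * (b : ℂ) * (d y : ℂ) ^ 2); -(2 * (a : ℂ) / (d y : ℂ) ^ 2), 0] with hN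
  have hdc' : Continuous fun y => (d y : ℂ) := Complex.continuous_ofReal.comp hdc
  have hNc : ∀ i j, Continuous fun y => N y i j := by
    intro i j
    fin_cases i <;> fin_cases j <;> simp only [hN, Fin.zero_eta, Fin.mk_one, Fin.isValue, of_apply,
      cons_val', cons_val_zero, cons_val_one, cons_val_fin_one]
    · exact continuous_const
    · fun_prop
    · exact (Continuous.div continuous_const (hdc'.pow 2) fun y => pow_ne_zero 2 (h.ne_zero y)).neg
    · exact continuous_const
  obtain ⟨E, hE0, hEl0, hE', hEd⟩ := exists_matrix_ode_family hNc
  set s : ℝ → ℝ := fun y => Real.sqrt (d y) with hs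
  have hspos : ∀ y, 0 < s y := fun y => Real.sqrt_pos.2 (h.pos y)
  have hs' : ∀ y, HasDerivAt (fun t => (s t : ℂ)) (e y / (2 * s y)) y := by
    intro y
    simpa using ((h.hasDerivAt y).sqrt (h.pos y).ne').ofReal_comp
  have hsc : ∀ y, (s y : ℂ) ≠ 0 := fun y => by exact_mod_cast (hspos y).ne'
  have hsd : ∀ y, (d y : ℂ) = (s y : ℂ) ^ 2 := fun y => by
    exact_mod_cast (Real.sq_sqrt (h.pos y).le).symm
  set D : ℝ → Matrix (Fin 2) (Fin 2) ℂ := fun y => !![(s y : ℂ)⁻¹, 0; 0, (s y : ℂ)] with hD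
  have hD' : ∀ y, HasEntryDerivAt D
      !![-(e y / (2 * s y)) / (s y : ℂ) ^ 2, 0; 0, (e y : ℂ) / (2 * s y)] y := by
    intro y i j
    fin_cases i <;> fin_cases j <;> simp [hD]
    · exact (hs' y).fun_inv (hsc y)
    · exact hasDerivAt_const y _
    · exact hasDerivAt_const y _
    · exact hs' y
  refine ⟨fun y l => D y * E l y, fun l => ?_, fun l y => ?_, fun y i j => ?_, fun y => ?_⟩
  · have : s 0 = 1 := by simp [hs, h.zero]
    ext i j
    fin_cases i <;> fin_cases j <;> simp [hE0, hD, this]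
  · have hmul := (hD' y).mul (hE' l y)
    have hgauge : !![-(e y / (2 * s y)) / (s y : ℂ) ^ 2, 0; 0, (e y : ℂ) / (2 * s y)]
        + D y * (l • N y) = formBar a b (d y) (e y) l * D y := by
      have := hsc y
      ext i j
      fin_cases i <;> fin_cases j <;> simp [hD, hN, formBar, hsd] <;> field_simp
    rw [← Matrix.smul_mul, ← Matrix.mul_assoc, ← Matrix.add_mul, hgauge, Matrix.mul_assoc] at hmul
    exact hmul
  · simp only [Matrix.mul_apply, Fin.sum_univ_two]
    exact ((hEd y 0 j).const_mul _).add ((hEd y 1 j).const_mul _)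
  · refine ⟨(s y)⁻¹, inv_pos.2 (hspos y), ?_⟩
    simp [hEl0, hD]

theorem isSmoothLoop_of_differentiable {G : ℂ → Matrix (Fin 2) (Fin 2) ℂ}
    (hG : ∀ i j, Differentiable ℂ (fun l => G l i j)) : IsSmoothLoop (fun l => G l) := by
  intro i j
  have h1 : ContDiff ℝ ((⊤ : ℕ∞) : WithTop ℕ∞) (fun t : ℝ => Complex.exp (t * Complex.I)) :=
    (Complex.ofRealCLM.contDiff.mul contDiff_const).cexp
  exact ((hG i j).contDiff.restrict_scalars ℝ).comp h1

theorem IsSmoothLoop.mul {g₁ g₂ : Circle → Matrix (Fin 2) (Fin 2) ℂ} (h₁ : IsSmoothLoop g₁)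
    (h₂ : IsSmoothLoop g₂) : IsSmoothLoop (fun l => g₁ l * g₂ l) := by
  intro i j
  simp only [Matrix.mul_apply, Fin.sum_univ_two]
  exact ((h₁ i 0).mul (h₂ 0 j)).add ((h₁ i 1).mul (h₂ 1 j))

theorem IsSmoothLoop.adjugate {g : Circle → Matrix (Fin 2) (Fin 2) ℂ} (h : IsSmoothLoop g) :
    IsSmoothLoop (fun l => (g l).adjugate) := by
  intro i j
  simp only [Matrix.adjugate_fin_two]
  fin_cases i <;> fin_cases j
  · exact h 1 1
  · exact (h 0 1).neg
  · exact (h 1 0).neg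
  · exact h 0 0

/-- The extended framing together with its Maurer-Cartan equations. -/
theorem exists_extendedFraming (h : IsProfile a b d e) :
    ∃ F : ℂ → Circle → Matrix (Fin 2) (Fin 2) ℂ, IsExtendedFraming (xi a b) F ∧
      (∀ l, F 0 l = 1) ∧
      (∀ (x y : ℝ) l, F (x + Complex.I * y) l =
        NormedSpace.exp ((x : ℂ) • xi a b l) * F (Complex.I * y) l) ∧
      ∀ (x y : ℝ) (l : Circle),
        HasEntryDerivAt (fun s : ℝ => F (s + Complex.I * y) l)
          (F (x + Complex.I * y) l * formX a b (d y) (e y) l) x ∧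
        HasEntryDerivAt (fun s : ℝ => F (x + Complex.I * s) l)
          (F (x + Complex.I * y) l * formY a b (d y) l) y := by
  obtain ⟨B, hB0, hB', hBd, hBr⟩ := exists_positiveFactor h
  have htr : ∀ (l : ℂ) (t : ℝ), (formBar a b (d t) (e t) l).trace = 0 := fun l t =>
    trace_formBar _ _ _ _ _
  have hdet : ∀ y l, (B y l).det = 1 := fun y l =>
    det_eq_one_of_deriv (htr l) (hB' l) (hB0 l) y
  have hBadj : ∀ y l, B y l * (B y l).adjugate = 1 := fun y l => by
    rw [Matrix.mul_adjugate, hdet, one_smul]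
  have hadjB : ∀ y l, (B y l).adjugate * B y l = 1 := fun y l => by
    rw [Matrix.adjugate_mul, hdet, one_smul]
  have hadj' : ∀ l y, HasEntryDerivAt (fun t => (B t l).adjugate)
      (-((B y l).adjugate * formBar a b (d y) (e y) l)) y := by
    intro l y
    have h1 := (hB' l y).adjugate
    rwa [Matrix.adjugate_mul_distrib, adjugate_eq_neg_of_trace_eq_zero (htr l y),
      Matrix.mul_neg] at h1
  -- Both sides solve the same initial value problem, as the coefficient is itself twisted.
  have hneg : ∀ y l, B y (-l) = tau (B y l) := by
    intro y l
    refine (eq_of_deriv (Y := fun t => tau (B t l)) (htr (-l)) (hB' (-l)) (fun t => ?_) (hB0 _) ?_ y).symm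
    · have h1 := (hB' l t).tau
      rwa [tau_mul, ← formBar_neg] at h1
    · rw [hB0, tau_one]
  -- Differentiating B⁻¹α₁B gives B⁻¹([α₁, iα₁ - α₂] + [α₁, α₂])B = 0, so it keeps its initial value
  -- ξ.
  have hconj : ∀ (y : ℝ) (l : Circle),
      (B y l).adjugate * formX a b (d y) (e y) l = xi a b l * (B y l).adjugate := by
    intro y l
    have hc : (B y l).adjugate * formX a b (d y) (e y) l * B y l = xi a b l := by
      have h1 := eq_of_hasEntryDerivAt_zero (y := y)
        (X := fun t => (B t l).adjugate * formX a b (d t) (e t) l * B t l) fun t _ => by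
          have h2 := ((hadj' l t).mul (hasEntryDerivAt_formX h l.coe_ne_zero t)).mul (hB' l t)
          convert h2 using 1
          rw [formBar_eq]
          simp only [Matrix.mul_sub, Matrix.sub_mul, Matrix.add_mul, Matrix.neg_mul,
            Matrix.mul_smul, Matrix.smul_mul, Matrix.mul_assoc]
          abel
      rw [h1]
      simp [hB0, h.zero, h.deriv_zero, formX_one_zero]
    calc (B y l).adjugate * formX a b (d y) (e y) l
        = (B y l).adjugate * formX a b (d y) (e y) l * (B y l * (B y l).adjugate) := by
          rw [hBadj, Matrix.mul_one]
      _ = _ := by rw [← Matrix.mul_assoc, hc]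
  set F : ℂ → Circle → Matrix (Fin 2) (Fin 2) ℂ := fun z l =>
    NormedSpace.exp (z • xi a b l) * (B z.im l).adjugate with hF
  have hF0 : ∀ l, F 0 l = 1 := fun l => by simp [hF, hB0]
  have hFadd : ∀ (x y : ℝ) l, F (x + Complex.I * y) l =
      NormedSpace.exp ((x : ℂ) • xi a b l) * F (Complex.I * y) l := by
    intro x y l
    simp [hF, exp_add_smul, Matrix.mul_assoc]
  have hder : ∀ (x y : ℝ) (l : Circle),
      HasEntryDerivAt (fun s : ℝ => F (s + Complex.I * y) l)
        (F (x + Complex.I * y) l * formX a b (d y) (e y) l) x ∧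
      HasEntryDerivAt (fun s : ℝ => F (x + Complex.I * s) l)
        (F (x + Complex.I * y) l * formY a b (d y) l) y := by
    intro x y l
    have him : ∀ x y : ℝ, (x + Complex.I * y : ℂ).im = y := by simp
    simp only [hF, him]
    constructor
    · have hw : HasDerivAt (fun s : ℝ => (s + Complex.I * y : ℂ)) 1 x := by
        simpa using (hasDerivAt_id x).ofReal_comp.add_const (Complex.I * y)
      have h1 := (hasEntryDerivAt_exp_smul (xi a b l) hw).mul_const (B y l).adjugate
      rwa [one_smul, commute_exp_smul, Matrix.mul_assoc, ← hconj, ← Matrix.mul_assoc] at h1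
    · have hw : HasDerivAt (fun s : ℝ => (x + Complex.I * s : ℂ)) Complex.I y := by
        simpa using ((hasDerivAt_id y).ofReal_comp.const_mul Complex.I).const_add (x : ℂ)
      have h1 := (hasEntryDerivAt_exp_smul (xi a b l) hw).mul (hadj' l y)
      convert h1 using 1
      rw [commute_exp_smul, formBar_eq, Matrix.smul_mul, Matrix.mul_assoc _ (xi a b l), ← hconj]
      simp only [Matrix.mul_sub, Matrix.mul_smul, Matrix.mul_assoc, neg_sub]
      abel
  refine ⟨F, fun z => ⟨⟨?_, fun l => ?_, fun l => ?_⟩, fun l => B z.im l,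
    ⟨?_, fun l => hdet _ _, fun l => ?_, B z.im, fun i j => (hBd z.im i j).diffContOnCl,
      fun _ => rfl, fun l _ => hdet _ _, hBr z.im⟩, fun l => ?_⟩, hF0, hFadd, hder⟩
  · exact (isSmoothLoop_exp_xi a b z).mul (isSmoothLoop_of_differentiable (hBd z.im)).adjugate
  · rw [Matrix.mem_specialUnitaryGroup_iff, Matrix.mem_unitaryGroup_iff]
    constructor
    · have hI : F (Complex.I * z.im) l * (F (Complex.I * z.im) l)ᴴ = 1 := by
        have h1 : ∀ t : ℝ, HasEntryDerivAt (fun s : ℝ => F (Complex.I * s) l)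
            (F (Complex.I * t) l * formY a b (d t) l) t := fun t => by
          simpa using (hder 0 t l).2
        simpa [hF0] using mul_conjTranspose_eq_of_deriv (y := z.im)
          (fun t => conjTranspose_formY a b (d t) l) (fun t _ => h1 t) (fun t _ => h1 t)
      have hz : z = z.re + Complex.I * z.im := by rw [mul_comm]; exact (Complex.re_add_im z).symm
      rw [hz, hFadd, Matrix.star_eq_conjTranspose, Matrix.conjTranspose_mul, Matrix.mul_assoc,
        ← Matrix.mul_assoc (F _ l), hI, Matrix.one_mul, exp_xi_mul_conjTranspose]
    · simp only [hF]
      rw [Matrix.det_mul, det_exp_xi, Matrix.det_adjugate, hdet]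
      simp
  · simp only [hF, Circle.coe_neg]
    rw [exp_xi_neg, hneg, tau_mul, tau_adjugate]
  · exact isSmoothLoop_of_differentiable (hBd z.im)
  · rw [Circle.coe_neg, hneg]
  · simp only [hF]
    rw [Matrix.mul_assoc, hadjB, Matrix.mul_one]

end Profile

end DelaunayFrame

namespace DelaunayFrame

open Matrix

/-! ### Uniqueness of the extended framing -/

theorem norm_le_one_of_diffContOnCl {f : ℂ → ℂ} (hf : DiffContOnCl ℂ f (Metric.ball 0 1))
    (h1 : ∀ l : Circle, ‖f l‖ ≤ 1) : ∀ z ∈ Metric.closedBall (0 : ℂ) 1, ‖f z‖ ≤ 1 := by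
  intro z hz
  refine Complex.norm_le_of_forall_mem_frontier_norm_le Metric.isBounded_ball hf (fun w hw => ?_)
    (by rwa [closure_ball (0 : ℂ) one_ne_zero])
  rw [frontier_ball (0 : ℂ) one_ne_zero] at hw
  exact h1 ⟨w, hw⟩

theorem eq_one_of_diffContOnCl {f : ℂ → ℂ} (hf : DiffContOnCl ℂ f (Metric.ball 0 1))
    (h1 : ∀ l : Circle, ‖f l‖ ≤ 1) (h0 : f 0 = 1) (l : Circle) : f l = 1 := by
  have hle := norm_le_one_of_diffContOnCl hf h1
  have hmax : IsMaxOn (norm ∘ f) (Metric.ball 0 1) 0 := fun z hz => by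
    simpa [h0] using hle z (Metric.ball_subset_closedBall hz)
  have h := Complex.eqOn_closedBall_of_isMaxOn_norm hf hmax
  have hl : (l : ℂ) ∈ Metric.closedBall (0 : ℂ) 1 :=
    mem_closedBall_zero_iff.2 l.norm_coe.le
  simpa [h0] using h hl

/-- A loop of unitary matrices that extends holomorphically to the disc, with value
`diag(r, 1/r)`, `r > 0`, at the centre, is trivial. -/
theorem eq_one_of_unitary_of_extends {W : ℂ → Matrix (Fin 2) (Fin 2) ℂ}
    (hW : ∀ i, DiffContOnCl ℂ (fun l => W l i i) (Metric.ball 0 1))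
    (hU : ∀ l : Circle, W l ∈ Matrix.unitaryGroup (Fin 2) ℂ) {r : ℝ} (hr : 0 < r)
    (h0 : W 0 0 0 = r) (h1 : W 0 1 1 = (r : ℂ)⁻¹) (l : Circle) : W l = 1 := by
  -- Entries of a unitary matrix have modulus at most 1, so the maximum principle at the centre
  -- gives r ≤ 1 and 1/r ≤ 1. Then each diagonal entry attains its maximum modulus at 0 and is
  -- constant.
  have hle : ∀ i (l : Circle), ‖W l i i‖ ≤ 1 := fun i l => entry_norm_bound_of_unitary (hU l) i i
  have hr1 : r ≤ 1 := by
    simpa [h0, abs_of_pos hr] using norm_le_one_of_diffContOnCl (hW 0) (hle 0) 0 (by simp)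
  have hr2 : r⁻¹ ≤ 1 := by
    simpa [h1, abs_of_pos hr] using norm_le_one_of_diffContOnCl (hW 1) (hle 1) 0 (by simp)
  have hr3 : r = 1 := le_antisymm hr1 ((inv_le_one₀ hr).1 hr2)
  have h00 : W l 0 0 = 1 := eq_one_of_diffContOnCl (hW 0) (hle 0) (by simp [h0, hr3]) l
  have h11 : W l 1 1 = 1 := eq_one_of_diffContOnCl (hW 1) (hle 1) (by simp [h1, hr3]) l
  -- Rows of length one with diagonal entry 1 leave no room off the diagonal.
  have hWW := Matrix.mem_unitaryGroup_iff.1 (hU l)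
  have e0 := congrFun (congrFun hWW 0) 0
  have e1 := congrFun (congrFun hWW 1) 1
  simp [Matrix.mul_apply, Fin.sum_univ_two, h00, h11, Matrix.star_apply] at e0 e1
  ext i j
  fin_cases i <;> fin_cases j <;> simp [h00, h11, e0, e1]

/-- The loop F₂⁻¹F₁ = B₂B₁⁻¹ is unitary on the circle and extends to the disc, so it is trivial. -/
theorem IsExtendedFraming.unique {ξ : ℂ → Matrix (Fin 2) (Fin 2) ℂ}
    {F₁ F₂ : ℂ → Circle → Matrix (Fin 2) (Fin 2) ℂ} (h₁ : IsExtendedFraming ξ F₁)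
    (h₂ : IsExtendedFraming ξ F₂) : F₁ = F₂ := by
  funext z l
  obtain ⟨hF₁, B₁, hB₁, hE₁⟩ := h₁ z
  obtain ⟨hF₂, B₂, hB₂, hE₂⟩ := h₂ z
  obtain ⟨G₁, hG₁, hGB₁, -, r₁, hr₁, hG₁0⟩ := hB₁.extends_to_disc
  obtain ⟨G₂, hG₂, hGB₂, -, r₂, hr₂, hG₂0⟩ := hB₂.extends_to_disc
  have hW : ∀ l : Circle, G₂ l * (G₁ l).adjugate = star (F₂ z l) * F₁ z l := by
    intro l
    have hu := Matrix.mem_unitaryGroup_iff'.1 (hF₂.mem_SU l).1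
    rw [hGB₁, hGB₂]
    calc B₂ l * (B₁ l).adjugate = star (F₂ z l) * F₂ z l * B₂ l * (B₁ l).adjugate := by
          rw [hu, Matrix.one_mul]
      _ = star (F₂ z l) * (F₁ z l * B₁ l) * (B₁ l).adjugate := by
          rw [Matrix.mul_assoc (star _), ← hE₂, hE₁]
      _ = star (F₂ z l) * F₁ z l * (B₁ l * (B₁ l).adjugate) := by
          simp only [Matrix.mul_assoc]
      _ = _ := by rw [Matrix.mul_adjugate, hB₁.det_eq_one, one_smul, Matrix.mul_one]
  have hone : G₂ l * (G₁ l).adjugate = 1 := by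
    refine eq_one_of_unitary_of_extends (W := fun l => G₂ l * (G₁ l).adjugate) (r := r₂ / r₁)
      (fun i => ?_) (fun l => ?_) (div_pos hr₂ hr₁) ?_ ?_ l
    · simp only [Matrix.mul_apply, Fin.sum_univ_two, Matrix.adjugate_fin_two]
      have hmul : ∀ {f g : ℂ → ℂ}, DiffContOnCl ℂ f (Metric.ball 0 1) →
          DiffContOnCl ℂ g (Metric.ball 0 1) →
          DiffContOnCl ℂ (fun l => f l * g l) (Metric.ball 0 1) := fun hf hg => hf.smul hg
      fin_cases i
      · exact (hmul (hG₂ 0 0) (hG₁ 1 1)).add (hmul (hG₂ 0 1) (hG₁ 1 0).neg)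
      · exact (hmul (hG₂ 1 0) (hG₁ 0 1).neg).add (hmul (hG₂ 1 1) (hG₁ 0 0))
    · rw [hW l]
      exact mul_mem (Unitary.star_mem (hF₂.mem_SU l).1) (hF₁.mem_SU l).1
    · simp [hG₁0, hG₂0, Matrix.adjugate_fin_two, div_eq_mul_inv]
    · simp [hG₁0, hG₂0, Matrix.adjugate_fin_two, div_eq_mul_inv, mul_comm]
  rw [hW l] at hone
  have hu := Matrix.mem_unitaryGroup_iff.1 (hF₂.mem_SU l).1
  calc F₁ z l = F₂ z l * star (F₂ z l) * F₁ z l := by rw [hu, Matrix.one_mul]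
    _ = F₂ z l := by rw [Matrix.mul_assoc, hone, Matrix.mul_one]

/-! ### The explicit formula -/

theorem omega_ne_zero {a b : ℝ} (hab : a ≠ b) (hab' : a ≠ -b) (l : Circle) :
    omega a b l ≠ 0 := by
  intro h
  have hl := l.coe_ne_zero
  have h1 : (a : ℂ) * l = -(b * (l : ℂ)⁻¹) := by
    have : Complex.I * ((b : ℂ) * (l : ℂ)⁻¹ + a * l) = 0 := by rw [← h, omega]; ring
    have := (mul_eq_zero.1 this).resolve_left Complex.I_ne_zero
    linear_combination this
  have h2 := congrArg norm h1
  simp only [norm_mul, norm_neg, norm_inv, Circle.norm_coe, Complex.norm_real, Real.norm_eq_abs,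
    inv_one, mul_one] at h2
  rcases abs_eq_abs.1 h2 with h3 | h3
  · exact hab h3
  · exact hab' h3

section Profile

variable {a b H : ℝ} {d e : ℝ → ℝ}

theorem Omega1_eq (hb : b ≠ 0) (hH : H ≠ 0) (h : IsProfile a b d e)
    (hv : ∀ y, v0 a b H y = 2 * b * H⁻¹ * d y) (y : ℝ) (l : ℂ) :
    Omega1 a b H y l = Complex.I * (b * d y * l⁻¹ + a * l / d y) := by
  have hd := h.ne_zero y
  have hb' : (b : ℂ) ≠ 0 := by exact_mod_cast hb
  have hH' : (H : ℂ) ≠ 0 := by exact_mod_cast hH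
  rw [Omega1, hv]
  push_cast
  field_simp

/-- A zero means λ² = -bd²/a; modulus 1 forces |b|d² = |a|, which leaves only minus the sign of ab.
-/
theorem Omega1_ne_zero (ha : a ≠ 0) (hb : b ≠ 0) (hH : H ≠ 0) (h : IsProfile a b d e)
    (hv : ∀ y, v0 a b H y = 2 * b * H⁻¹ * d y) (l : Circle)
    (hl : (l : ℂ) ^ 2 ≠ -((a * b / |a * b| : ℝ) : ℂ)) (y : ℝ) : Omega1 a b H y l ≠ 0 := by
  intro h0
  have hl0 := l.coe_ne_zero
  have hd := h.ne_zero y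
  have ha' : (a : ℂ) ≠ 0 := by exact_mod_cast ha
  rw [Omega1_eq hb hH h hv] at h0
  have h1 := (mul_eq_zero.1 h0).resolve_left Complex.I_ne_zero
  have h2 : (l : ℂ) ^ 2 = ((-(b * d y ^ 2 / a) : ℝ) : ℂ) := by
    push_cast
    field_simp at h1 ⊢
    linear_combination h1
  have hd2 : 0 < d y ^ 2 := pow_pos (h.pos y) 2
  have h3 : |b * d y ^ 2 / a| = 1 := by
    have h4 := congrArg norm h2
    rw [Complex.norm_real, norm_pow, Circle.norm_coe, one_pow, Real.norm_eq_abs, abs_neg] at h4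
    exact h4.symm
  rw [abs_div, abs_mul, abs_of_pos hd2, div_eq_one_iff_eq (abs_pos.2 ha).ne'] at h3
  apply hl
  rw [h2, ← Complex.ofReal_neg]
  congr 2
  rw [abs_mul, ← h3]
  rw [div_eq_div_iff ha (by have := abs_pos.2 hb; positivity)]
  have ha2 : |a| * |a| = a * a := abs_mul_abs_self a
  rw [← h3] at ha2
  linear_combination b * ha2

theorem continuous_Omega1 (hb : b ≠ 0) (hH : H ≠ 0) (h : IsProfile a b d e)
    (hv : ∀ y, v0 a b H y = 2 * b * H⁻¹ * d y) (l : ℂ) :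
    Continuous fun y => Omega1 a b H y l := by
  have hdc : Continuous fun y => (d y : ℂ) :=
    continuous_iff_continuousAt.2 fun y => (h.hasDerivAt_ofReal y).continuousAt
  simp only [Omega1_eq hb hH h hv]
  exact continuous_const.mul (((continuous_const.mul hdc).mul continuous_const).add
    (continuous_const.div hdc h.ne_zero))

/-- The quotient is ρ = (bd + aλ²/d)/(b + aλ²). If λ² is not real, ρ(y) can be real only if it
equals 1/d > 0. If λ² is real, ρ is real on the whole segment, starts at 1 and has no zero, so it
stays positive. -/
theorem Omega1_div_omega_mem_slitPlane (ha : a ≠ 0) (hb : b ≠ 0) (hab : a ≠ b) (hab' : a ≠ -b)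
    (hH : H ≠ 0) (h : IsProfile a b d e) (hv : ∀ y, v0 a b H y = 2 * b * H⁻¹ * d y)
    (l : Circle) {y : ℝ} (hy : ∀ ζ ∈ Set.uIcc 0 y, Omega1 a b H ζ l ≠ 0) :
    Omega1 a b H y l / omega a b l ∈ Complex.slitPlane := by
  have hω := omega_ne_zero hab hab' l
  have hl0 := l.coe_ne_zero
  have hden : (b : ℂ) + a * (l : ℂ) ^ 2 ≠ 0 := by
    intro h0
    apply hω
    rw [omega]
    field_simp
    linear_combination Complex.I * h0
  have hρ : ∀ ζ, Omega1 a b H ζ l / omega a b l =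
      (b * d ζ + a * (l : ℂ) ^ 2 / d ζ) / (b + a * (l : ℂ) ^ 2) := by
    intro ζ
    have hd := h.ne_zero ζ
    have hω' : omega a b l = Complex.I * (b + a * (l : ℂ) ^ 2) * (l : ℂ)⁻¹ := by
      rw [omega]
      field_simp
    rw [Omega1_eq hb hH h hv, hω']
    have := Complex.I_ne_zero
    field_simp
  set ρ : ℝ → ℂ := fun ζ => Omega1 a b H ζ l / omega a b l with hρdef
  have hρ0 : ρ 0 = 1 := by
    simp only [hρdef, hρ, h.zero]
    simp [div_self hden]
  have hρne : ∀ ζ ∈ Set.uIcc 0 y, ρ ζ ≠ 0 := fun ζ hζ => div_ne_zero (hy ζ hζ) hω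
  change ρ y ∈ Complex.slitPlane
  rw [Complex.mem_slitPlane_iff]
  by_contra! hcon
  obtain ⟨hre, him⟩ := hcon
  have hreal : ((l : ℂ) ^ 2).im = 0 := by
    by_contra hu
    have hdpos := h.pos y
    -- `ρ y` is real, and `1` and `l ^ 2` are linearly independent over `ℝ`
    have hρy : ρ y = ((ρ y).re : ℂ) := Complex.ext rfl (by simpa using him)
    have h1 : (b : ℂ) * d y + a * (l : ℂ) ^ 2 / d y = (ρ y).re * (b + a * (l : ℂ) ^ 2) := by
      rw [← hρy]
      simp only [hρdef, hρ]
      rw [div_mul_cancel₀ _ hden]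
    generalize (l : ℂ) ^ 2 = u at h1 hu
    have h2 := congrArg Complex.im h1
    have h3 := congrArg Complex.re h1
    simp [← Complex.ofReal_mul, Complex.div_ofReal_im, Complex.div_ofReal_re] at h2 h3
    have h4 : (d y)⁻¹ = (ρ y).re := by
      have : a * u.im * ((d y)⁻¹ - (ρ y).re) = 0 := by
        rw [div_eq_mul_inv] at h2
        linear_combination h2
      have := (mul_eq_zero.1 this).resolve_left (mul_ne_zero ha hu)
      linarith
    have : 0 < (d y)⁻¹ := inv_pos.2 hdpos
    linarith
  have hρreal : ∀ ζ, (ρ ζ).im = 0 := by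
    intro ζ
    obtain ⟨u, hu⟩ : ∃ u : ℝ, (l : ℂ) ^ 2 = u :=
      ⟨((l : ℂ) ^ 2).re, Complex.ext rfl (by simpa using hreal)⟩
    have : ρ ζ = (((b * d ζ + a * u / d ζ) / (b + a * u) : ℝ) : ℂ) := by
      simp only [hρdef, hρ, hu]
      push_cast
      rfl
    rw [this, Complex.ofReal_im]
  have hcont : Continuous fun ζ => (ρ ζ).re :=
    Complex.continuous_re.comp ((continuous_Omega1 hb hH h hv l).div_const _)
  have hmem : (0 : ℝ) ∈ Set.uIcc (ρ 0).re (ρ y).re := by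
    rw [hρ0, Complex.one_re, Set.mem_uIcc]
    exact Or.inr ⟨hre, zero_le_one⟩
  obtain ⟨ζ, hζ, hζ0⟩ := intermediate_value_uIcc (hcont.continuousOn (s := Set.uIcc 0 y)) hmem
  exact hρne ζ hζ (Complex.ext hζ0 (hρreal ζ))

end Profile

end DelaunayFrame

namespace DelaunayFrame

open Matrix

/-! ### The gauge T and the frame along x = 0 -/

section Profile

variable {a b H : ℝ} {d e : ℝ → ℝ}

/-- The denominator is 4b d Ω₁, so the integrand can be singular only at zeros of Ω₁. -/
theorem integrand_eq (hb : b ≠ 0) (hH : H ≠ 0) (h : IsProfile a b d e)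
    (hv : ∀ y, v0 a b H y = 2 * b * H⁻¹ * d y) (l : ℂ) (y : ℝ) :
    integrand a b H l y = 2 * a * l / (d y * Omega1 a b H y l) := by
  have hd := h.ne_zero y
  have hb' : (b : ℂ) ≠ 0 := by exact_mod_cast hb
  have hH' : (H : ℂ) ≠ 0 := by exact_mod_cast hH
  have hden : 4 * Complex.I * a * b * l + Complex.I * (H : ℂ) ^ 2 * l⁻¹ * (v0 a b H y : ℂ) ^ 2 =
      4 * b * (d y * Omega1 a b H y l) := by
    rw [Omega1_eq hb hH h hv, hv]
    push_cast
    field_simp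
    ring
  rw [integrand, hden, show (8 : ℂ) * a * b * l = 4 * b * (2 * a * l) by ring,
    mul_div_mul_left _ _ (mul_ne_zero (by norm_num) hb')]

theorem T_eq (hb : b ≠ 0) (hH : H ≠ 0) (h : IsProfile a b d e)
    (hv : ∀ y, v0 a b H y = 2 * b * H⁻¹ * d y) (y : ℝ) (l : ℂ) :
    T a b H y l = (sqrtOmega a b H y l)⁻¹ •
      !![Omega1 a b H y l, -(Complex.I * (e y / (2 * d y))); 0, omega a b l] := by
  have hd := h.ne_zero y
  have hb' : (b : ℂ) ≠ 0 := by exact_mod_cast hb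
  have hH' : (H : ℂ) ≠ 0 := by exact_mod_cast hH
  have hder : deriv (v0 a b H) y = 2 * b * H⁻¹ * e y := by
    rw [funext hv]
    exact ((h.hasDerivAt y).const_mul _).deriv
  have hentry : -(Complex.I / 2) * (v0 a b H y : ℂ)⁻¹ * (deriv (v0 a b H) y : ℝ) =
      -(Complex.I * (e y / (2 * d y))) := by
    rw [hder, hv]
    push_cast
    field_simp
  rw [T, hentry]

theorem T_zero (hab : a ≠ b) (hab' : a ≠ -b) (hb : b ≠ 0) (hH : H ≠ 0) (h : IsProfile a b d e)
    (hv : ∀ y, v0 a b H y = 2 * b * H⁻¹ * d y) (l : Circle) : T a b H 0 l = 1 := by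
  have hω := omega_ne_zero hab hab' l
  have hΩ : Omega1 a b H 0 l = omega a b l := by
    rw [Omega1_eq hb hH h hv, omega, h.zero]
    push_cast
    ring
  rw [T_eq hb hH h hv, sqrtOmega, hΩ, div_self hω, Complex.one_cpow, mul_one, h.deriv_zero]
  ext i j
  fin_cases i <;> fin_cases j <;> simp [hω]

theorem hasDerivAt_Omega1 (hb : b ≠ 0) (hH : H ≠ 0) (h : IsProfile a b d e)
    (hv : ∀ y, v0 a b H y = 2 * b * H⁻¹ * d y) {l : ℂ} (hl : l ≠ 0) (y : ℝ) :
    HasDerivAt (fun t => Omega1 a b H t l)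
      (-(Complex.I * (e y / d y) * (-(b * d y * l⁻¹) + a * l / d y))) y := by
  have hd := h.ne_zero y
  have h1 := h.hasDerivAt_ofReal y
  simp only [Omega1_eq hb hH h hv]
  refine ((((h1.const_mul (b : ℂ)).mul_const l⁻¹).add
    ((hasDerivAt_const y ((a : ℂ) * l)).div h1 hd)).const_mul Complex.I).congr_deriv ?_
  field_simp
  ring

theorem hasDerivAt_sqrtOmega {l : ℂ} {y : ℝ} {Ω' : ℂ} (hω : omega a b l ≠ 0)
    (hΩ : HasDerivAt (fun t => Omega1 a b H t l) Ω' y)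
    (hs : Omega1 a b H y l / omega a b l ∈ Complex.slitPlane) :
    HasDerivAt (fun t => sqrtOmega a b H t l)
      (sqrtOmega a b H y l * (Ω' / (2 * Omega1 a b H y l))) y := by
  have hρ := Complex.slitPlane_ne_zero hs
  have h1 : HasDerivAt (fun w : ℂ => w ^ (1 / 2 : ℂ)) _ (Omega1 a b H y l / omega a b l) :=
    (hasDerivAt_id _).cpow_const hs
  have h2 := (HasDerivAt.comp_of_eq y h1 (hΩ.div_const (omega a b l)) rfl).const_mul (omega a b l)
  refine h2.congr_deriv ?_
  have hΩ0 : Omega1 a b H y l ≠ 0 := fun h0 => hρ (by rw [h0, zero_div])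
  rw [sqrtOmega, id, Complex.cpow_sub _ _ hρ, Complex.cpow_one]
  field_simp

/-- `T` transforms the Maurer-Cartan form into a multiple of the potential. -/
theorem hasEntryDerivAt_T (hb : b ≠ 0) (hH : H ≠ 0) (h : IsProfile a b d e)
    (hv : ∀ y, v0 a b H y = 2 * b * H⁻¹ * d y) {l : ℂ} {y : ℝ} (hl : l ≠ 0)
    (hω : omega a b l ≠ 0) (hs : Omega1 a b H y l / omega a b l ∈ Complex.slitPlane) :
    HasEntryDerivAt (fun t => T a b H t l)
      (T a b H y l * formY a b (d y) l -
        (Complex.I + integrand a b H l y) • (xi a b l * T a b H y l)) y := by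
  have hd := h.ne_zero y
  have hΩ := hasDerivAt_Omega1 hb hH h hv hl y
  have hsq := hasDerivAt_sqrtOmega hω hΩ hs
  have hρ := Complex.slitPlane_ne_zero hs
  have hΩ0 : Omega1 a b H y l ≠ 0 := fun h0 => hρ (by rw [h0, zero_div])
  have hs0 : sqrtOmega a b H y l ≠ 0 := by
    rw [sqrtOmega]
    exact mul_ne_zero hω (by simp [Complex.cpow_eq_zero_iff, hρ])
  have hI := Complex.I_mul_I
  have hΩeq := Omega1_eq hb hH h hv y l
  -- the diagonal entry `p` of `α₁` and the lower left entry `g` of `α₂`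
  obtain ⟨p, hp⟩ : ∃ p, p = Complex.I * ((e y : ℂ) / (2 * d y)) := ⟨_, rfl⟩
  obtain ⟨g, hg⟩ : ∃ g, g = -((b : ℂ) * d y * l⁻¹) + a * l / d y := ⟨_, rfl⟩
  obtain ⟨q, hq⟩ : ∃ q, q = -((a : ℂ) * (l⁻¹ * (d y : ℂ)⁻¹)) + b * d y * l := ⟨_, rfl⟩
  obtain ⟨w, hw⟩ : ∃ w, w = Complex.I * ((a : ℂ) * (l⁻¹ * (d y : ℂ)⁻¹) + b * d y * l) := ⟨_, rfl⟩
  -- The upper left entry of the Lax equation.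
  have hp' : HasDerivAt (fun t => Complex.I * ((e t : ℂ) / (2 * d t)))
      (w * g - q * Omega1 a b H y l) y := by
    have h1 := hasEntryDerivAt_formX h hl y 0 0
    simp [formX, formY] at h1
    refine h1.congr_deriv ?_
    rw [hΩeq, hw, hg, hq]
  have hΩ' : -(Complex.I * (e y / d y) * (-(b * d y * l⁻¹) + a * l / d y)) = -(2 * p * g) := by
    rw [hp, hg]
    field_simp
  -- The choice of f: i + f' is the quotient of the lower left entries of α₂ and α₁.
  have hf : Complex.I + integrand a b H l y = g / Omega1 a b H y l := by
    rw [integrand_eq hb hH h hv]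
    field_simp
    rw [hΩeq, hg]
    field_simp
    linear_combination (b * (d y : ℂ) ^ 2 + a * l ^ 2) * hI
  -- This says det α₁ = det ξ, which is again the energy relation.
  have hdet : w * Omega1 a b H y l + p ^ 2 = Complex.I * (a * l⁻¹ + b * l) * omega a b l := by
    rw [hw, hΩeq, hp, omega]
    have hen := h.energy_ofReal y
    field_simp
    linear_combination l ^ 2 * hen
  rw [hΩ'] at hΩ hsq
  have hsinv := hsq.fun_inv hs0
  simp only [T_eq hb hH h hv]
  rw [hf, ← hp]
  intro i j
  fin_cases i <;> fin_cases j <;> simp [formY, xi, ← hg, ← hq]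
  · refine (hsinv.mul hΩ).congr_deriv ?_
    field_simp
    ring
  · refine (hsinv.mul hp').neg.congr_deriv ?_
    rw [← hp]
    field_simp
    linear_combination (-l * g) * hdet -
      g * Complex.I * a * omega a b l * mul_inv_cancel₀ hl
  · refine (hasDerivAt_const y (0 : ℂ)).congr_deriv ?_
    rw [omega]
    field_simp
    ring
  · refine (hsinv.mul_const (omega a b l)).congr_deriv ?_
    rw [omega]
    field_simp

theorem continuousAt_integrand (hb : b ≠ 0) (hH : H ≠ 0) (h : IsProfile a b d e)
    (hv : ∀ y, v0 a b H y = 2 * b * H⁻¹ * d y) {l : ℂ} {y : ℝ} (hy : Omega1 a b H y l ≠ 0) :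
    ContinuousAt (integrand a b H l) y := by
  rw [funext (integrand_eq hb hH h hv l)]
  exact continuousAt_const.div ((h.hasDerivAt_ofReal y).continuousAt.mul
    (continuous_Omega1 hb hH h hv l).continuousAt) (mul_ne_zero (h.ne_zero y) hy)

theorem measurable_integrand (hb : b ≠ 0) (hH : H ≠ 0) (h : IsProfile a b d e)
    (hv : ∀ y, v0 a b H y = 2 * b * H⁻¹ * d y) (l : ℂ) : Measurable (integrand a b H l) := by
  rw [funext (integrand_eq hb hH h hv l)]
  have hdc : Continuous fun y => (d y : ℂ) :=
    continuous_iff_continuousAt.2 fun y => (h.hasDerivAt_ofReal y).continuousAt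
  exact measurable_const.div (hdc.mul (continuous_Omega1 hb hH h hv l)).measurable

theorem intervalIntegrable_integrand (hb : b ≠ 0) (hH : H ≠ 0) (h : IsProfile a b d e)
    (hv : ∀ y, v0 a b H y = 2 * b * H⁻¹ * d y) {l : ℂ} {y : ℝ}
    (hy : ∀ ζ ∈ Set.uIcc 0 y, Omega1 a b H ζ l ≠ 0) :
    IntervalIntegrable (integrand a b H l) MeasureTheory.volume 0 y :=
  ContinuousOn.intervalIntegrable fun ζ hζ =>
    (continuousAt_integrand hb hH h hv (hy ζ hζ)).continuousWithinAt

/-- The explicit formula along the line `x = 0`. -/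
theorem eq_exp_mul_T (ha : a ≠ 0) (hb : b ≠ 0) (hab : a ≠ b) (hab' : a ≠ -b) (hH : H ≠ 0)
    (h : IsProfile a b d e) (hv : ∀ y, v0 a b H y = 2 * b * H⁻¹ * d y) (l : Circle) {y : ℝ}
    (hy : ∀ ζ ∈ Set.uIcc 0 y, Omega1 a b H ζ l ≠ 0) {G : ℝ → Matrix (Fin 2) (Fin 2) ℂ}
    (hG0 : G 0 = 1) (hG : ∀ t, HasEntryDerivAt G (G t * formY a b (d t) l) t) :
    G y = NormedSpace.exp (boldf a b H 0 y l • xi a b l) * T a b H y l := by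
  have hsub : ∀ t ∈ Set.uIcc 0 y, Set.uIcc 0 t ⊆ Set.uIcc 0 y := fun t ht =>
    Set.uIcc_subset_uIcc Set.left_mem_uIcc ht
  have hf : ∀ t ∈ Set.uIcc 0 y, HasDerivAt (fun t => boldf a b H 0 t l)
      (Complex.I + integrand a b H l t) t := by
    intro t ht
    have h1 := intervalIntegral.integral_hasDerivAt_right
      (intervalIntegrable_integrand hb hH h hv fun ζ hζ => hy ζ (hsub t ht hζ))
      (measurable_integrand hb hH h hv l).stronglyMeasurable.stronglyMeasurableAtFilter
      (continuousAt_integrand hb hH h hv (hy t ht))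
    have h2 : HasDerivAt (fun t : ℝ => ((0 : ℝ) : ℂ) + Complex.I * t) Complex.I t := by
      simpa using (hasDerivAt_id t).ofReal_comp.const_mul Complex.I
    exact h2.add h1
  -- The term (i + f')ξ from the exponential cancels the one in T', leaving R' = Rα₂.
  have hR : ∀ t ∈ Set.uIcc 0 y, HasEntryDerivAt
      (fun t => NormedSpace.exp (boldf a b H 0 t l • xi a b l) * T a b H t l)
      (NormedSpace.exp (boldf a b H 0 t l • xi a b l) * T a b H t l * formY a b (d t) l) t := by
    intro t ht
    have hs := Omega1_div_omega_mem_slitPlane ha hb hab hab' hH h hv l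
      fun ζ hζ => hy ζ (hsub t ht hζ)
    have h1 := (hasEntryDerivAt_exp_smul (xi a b l) (hf t ht)).mul
      (hasEntryDerivAt_T hb hH h hv l.coe_ne_zero (omega_ne_zero hab hab' l) hs)
    convert h1 using 1
    rw [commute_exp_smul]
    simp only [Matrix.mul_sub, Matrix.mul_smul, Matrix.smul_mul, Matrix.mul_assoc]
    abel
  have hskew : ∀ t, (formY a b (d t) l)ᴴ = -formY a b (d t) l := fun t =>
    conjTranspose_formY a b (d t) l
  have hGG : G y * (G y)ᴴ = 1 := by
    simpa [hG0] using mul_conjTranspose_eq_of_deriv (y := y) hskew (fun t _ => hG t)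
      (fun t _ => hG t)
  -- Both solve X' = Xα₂ with α₂ skew-Hermitian, so RG* is constant; as G is unitary, R = G.
  have hRG : NormedSpace.exp (boldf a b H 0 y l • xi a b l) * T a b H y l * (G y)ᴴ = 1 := by
    rw [mul_conjTranspose_eq_of_deriv hskew hR (fun t _ => hG t), hG0,
      T_zero hab hab' hb hH h hv]
    simp [boldf]
  have hGG' : (G y)ᴴ * G y = 1 := mul_eq_one_comm.1 hGG
  rw [← Matrix.one_mul (G y), ← hRG, Matrix.mul_assoc _ (G y)ᴴ, hGG', Matrix.mul_one]

end Profile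

end DelaunayFrame
theorem mainTheorem8 (a b H : ℝ) (ha : a ≠ 0) (hb : b ≠ 0) (hab : a ≠ b) (hab' : a ≠ -b)
    (hH : H ≠ 0) :
    -- the ingredients of the formula are well defined
    (Differentiable ℝ (DelaunayFrame.v0 a b H) ∧ ∀ y : ℝ, DelaunayFrame.v0 a b H y ≠ 0) ∧
    (∀ l : Circle, DelaunayFrame.omega a b l ≠ 0) ∧
    (∀ l : Circle, (l : ℂ) ^ 2 ≠ -((a * b / |a * b| : ℝ) : ℂ) →
      ∀ y : ℝ, DelaunayFrame.Omega1 a b H y l ≠ 0) ∧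
    -- the potential in normal form generates exactly one extended framing
    (∃! F : ℂ → Circle → Matrix (Fin 2) (Fin 2) ℂ,
      DelaunayFrame.IsExtendedFraming (DelaunayFrame.xi a b) F) ∧
    ∀ F : ℂ → Circle → Matrix (Fin 2) (Fin 2) ℂ,
      DelaunayFrame.IsExtendedFraming (DelaunayFrame.xi a b) F →
      -- its Maurer-Cartan form is that of the Delaunay surface with conformal factor `v₀²`
      (∀ (x y : ℝ) (l : Circle) (i j : Fin 2),
        HasDerivAt (fun s : ℝ => F (s + Complex.I * y) l i j)
          ((F (x + Complex.I * y) l * DelaunayFrame.alpha1 a b H y l) i j) x ∧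
        HasDerivAt (fun s : ℝ => F (x + Complex.I * s) l i j)
          ((F (x + Complex.I * y) l * DelaunayFrame.alpha2 a b H y l) i j) y) ∧
      -- and it is given by the explicit formula
      ∀ (x y : ℝ) (l : Circle),
        (∀ ζ ∈ Set.uIcc 0 y, DelaunayFrame.Omega1 a b H ζ l ≠ 0) →
        DelaunayFrame.Omega1 a b H y l / DelaunayFrame.omega a b l ∈ Complex.slitPlane ∧
        IntervalIntegrable (DelaunayFrame.integrand a b H l) MeasureTheory.volume 0 y ∧
        F (x + Complex.I * y) l =
          NormedSpace.exp (DelaunayFrame.boldf a b H x y l • DelaunayFrame.xi a b l) *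
            DelaunayFrame.T a b H y l := by
  obtain ⟨d, e, h, hv'⟩ := DelaunayFrame.exists_isProfile ha hb
  have hv := hv' H
  obtain ⟨F₀, hF₀, hF₀0, hF₀add, hF₀der⟩ := DelaunayFrame.exists_extendedFraming h
  refine ⟨⟨fun y => ?_, fun y => ?_⟩, DelaunayFrame.omega_ne_zero hab hab',
    DelaunayFrame.Omega1_ne_zero ha hb hH h hv, ⟨F₀, hF₀, fun F hF => hF.unique hF₀⟩,
    fun F hF => ?_⟩
  · rw [funext hv]
    exact ((h.hasDerivAt y).const_mul _).differentiableAt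
  · rw [hv]
    exact mul_ne_zero (mul_ne_zero (mul_ne_zero two_ne_zero hb) (inv_ne_zero hH)) (h.pos y).ne'
  -- By uniqueness it suffices to treat the framing already constructed.
  obtain rfl : F = F₀ := hF.unique hF₀
  refine ⟨fun x y l i j => ?_, fun x y l hy => ⟨?_, ?_, ?_⟩⟩
  · rw [DelaunayFrame.alpha1_eq hb hH h hv, DelaunayFrame.alpha2_eq hb hH h hv]
    exact ⟨(hF₀der x y l).1 i j, (hF₀der x y l).2 i j⟩
  · exact DelaunayFrame.Omega1_div_omega_mem_slitPlane ha hb hab hab' hH h hv l hy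
  · exact DelaunayFrame.intervalIntegrable_integrand hb hH h hv hy
  · have hG := DelaunayFrame.eq_exp_mul_T ha hb hab hab' hH h hv l hy
      (G := fun t => F (Complex.I * t) l) (by simp [hF₀0])
      (fun t => by simpa using (hF₀der 0 t l).2)
    have hx : DelaunayFrame.boldf a b H x y l = x + DelaunayFrame.boldf a b H 0 y l := by
      simp only [DelaunayFrame.boldf, Complex.ofReal_zero]
      ring
    rw [hF₀add, hG, hx, DelaunayFrame.exp_add_smul, Matrix.mul_assoc]
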